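/- **Setting.** A propositional rule has the form $a_1\,\mathtt{v}\cdots\mathtt{v}\,a_n \mathrel{:-} b_1,\dots,b_k,\mathtt{not}\,b_{k+1},\dots,\mathtt{not}\,b_m$ with classical literals (atoms $a$ or $\neg a$); $H(r)$, $B^+(r)$, $B^-(r)$ are the sets of its head, positive body and negative body literals. A set $X$ of literals *defeats* $r$ if $X\cap B^-(r)\ne\emptyset$. The answer sets $\mathcal{AS}(P)$ of a ground program $P$ are the sets $I$ that are minimal among the consistent sets closed under the Gelfond–Lifschitz reduct $P^I$. A weak constraint $:\sim B.\ [w:l]$ has a weight $w\ge 1$ and a level $l\ge 1$; the optimal answer sets $\mathcal{OAS}(P)$ are the answer sets $A$ of the part of $P$ without weak constraints that minimize $\sum_{i=1}^{l_{\max}} f(i)\cdot(\text{sum of the weights of the level-}i\text{ weak constraints violated by }A)$, where $f(1)=1$, $f(n)=f(n-1)\cdot|WC(P)|\cdot w_{\max}+1$ for $n>1$, $WC(P)$ is the set of weak constraints of $P$, and $w_{\max}$, $l_{\max}$ are the maximum weight and level occurring in $WC(P)$. Programs with variables have the (optimal) answer sets of their ground instantiation over their constants (or one arbitrary constant if there are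 none). A *prioritized program* $\mathcal P=(P,<)$ is a finite set $P$ of propositional rules with exactly one head literal together with a strict partial order $<$ on $P$ ($r<r'$ means that $r$ has higher priority). $\mathcal{FP}(\mathcal P)$ is the set of all $(P,<')$ where $<'$ is a total order of $P$ refining $<$. *B-preferred answer sets.* Let $<$ be a total order of $P$, and let $A\in\mathcal{AS}(P)$. The dual reduct ${}^A\mathcal P$ is obtained by deleting the rules with $B^+(r)\not\subseteq A$ and deleting the positive bodies of the remaining ones; its rules $r_1,\dots,r_n$ are ordered as their $<$-first originals. Put $S_0=\emptyset$, and $S_i=S_{i-1}$ if $S_{i-1}$ defeats $r_i$ or if $H(r_i)\subseteq A$ and $A$ defeats $r_i$; otherwise $S_i=S_{i-1}\cup H(r_i)$. Let $C(A)=S_n$ if $S_n$ is consistent, and otherwise let $C(A)$ be the set of all literals over the atoms of ${}^A\mathcal P$. Then $A$ is B-preferred for $(P,<)$ iff $A$ is an answer set of the dual reduct and $C(A)=A$. If $<$ is not total, $A\in\mathcal{AS}(P)$ is B-preferred iff it is so for some member of $\mathcal{FP}(\mathcal P)$. The set of B-preferred answer sets is denoted $\mathcal{BPAS}$. *Weakly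 preferred answer sets.* For total orders $<_1,<_2$ of $P$, $d(<_1,<_2)$ is the number of pairs $(m,m')$ with $m<_1m'$ and $m'<_2m$. For $A\in\mathcal{AS}(P)$ let $$pvd_{\mathcal P}(A)=\min\{d(<_1,<_2)\mid (P,<_1)\in\mathcal{FP}(\mathcal P),\ <_2\text{ a total order of }P,\ A\in\mathcal{BPAS}(P,<_2)\},$$ and $pvd(\mathcal P)=\min\{pvd_{\mathcal P}(A)\mid A\in\mathcal{AS}(P)\}$. The set $w\mathcal{PAS}(\mathcal P)$ of weakly preferred answer sets consists of the $A\in\mathcal{AS}(P)$ with $pvd_{\mathcal P}(A)=pvd(\mathcal P)$. *Representation.* Let the constants be totally ordered by a built-in order $<$, and name literals and rules by constants, distinct literals (rules) having distinct names. $F(\mathcal P)$ consists of the facts $rule(r)$, $head(c,r)$, $pbl(a,r)$ ($a\in B^+(r)$), $nbl(b,r)$ ($b\in B^-(r)$) for each $r\in P$ with $H(r)=\{c\}$, of $compl(a,\neg a)$ for each atom $a$ such that both $a$ and $\neg a$ occur in $P$, and of $pr(r,r')$ for each pair $r<r'$ in the transitive reduction of $<$. *Meta-interpreter.* $P_{I_{\mathrm{weak}}}$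 is the program - $in\_AS(X) \mathrel{:-} head(X,R),\ pos\_body\_true(R),\ \mathtt{not}\ neg\_body\_false(R).$ - $pos\_body\_exists(R) \mathrel{:-} pbl(X,R).$ - $pos\_body\_true(R) \mathrel{:-} rule(R),\ \mathtt{not}\ pos\_body\_exists(R).$ - $pbl\_inbetween(X,Y,R) \mathrel{:-} pbl(X,R),\ pbl(Y,R),\ pbl(Z,R),\ X<Z,\ Z<Y.$ - $pbl\_notlast(X,R) \mathrel{:-} pbl(X,R),\ pbl(Y,R),\ X<Y.$ - $pbl\_notfirst(X,R) \mathrel{:-} pbl(X,R),\ pbl(Y,R),\ Y<X.$ - $pos\_body\_true\_upto(R,X) \mathrel{:-} pbl(X,R),\ \mathtt{not}\ pbl\_notfirst(X,R),\ in\_AS(X).$ - $pos\_body\_true\_upto(R,X) \mathrel{:-} pos\_body\_true\_upto(R,Y),\ pbl(X,R),\ in\_AS(X),\ Y<X,\ \mathtt{not}\ pbl\_inbetween(Y,X,R).$ - $pos\_body\_true(R) \mathrel{:-} pos\_body\_true\_upto(R,X),\ \mathtt{not}\ pbl\_notlast(X,R).$ - $neg\_body\_false(Y) \mathrel{:-}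 nbl(X,Y),\ in\_AS(X).$ - $\mathrel{:-} compl(X,Y),\ in\_AS(X),\ in\_AS(Y).$ - $pr(X,Y)\ \mathtt{v}\ pr(Y,X) \mathrel{:-} rule(X),\ rule(Y),\ X\neq Y.$ - $pr(X,Z) \mathrel{:-} pr(X,Y),\ pr(Y,Z).$ - $\mathrel{:-} pr(X,X).$ - the same three clauses with $pr1$ in place of $pr$ - $\mathrel{:\sim} rule(X),\ rule(Y),\ pr(X,Y),\ pr1(Y,X).\ [1:1]$ - $lit(X,Y) \mathrel{:-} head(X,Y),\ pos\_body\_true(Y),\ \mathtt{not}\ defeat\_local(Y),\ \mathtt{not}\ in\_AS(X).$ - $lit(X,Y) \mathrel{:-} head(X,Y),\ pos\_body\_true(Y),\ \mathtt{not}\ defeat\_local(Y),\ \mathtt{not}\ defeat\_global(Y).$ - $defeat\_local(Y) \mathrel{:-} nbl(X,Y),\ lit(X,Y1),\ pr1(Y1,Y).$ - $defeat\_global(Y) \mathrel{:-} nbl(X,Y),\ in\_AS(X).$ - $in\_CP(X) \mathrel{:-} lit(X,Y).$ - $\mathrel{:-} in\_CP(X),\ \mathtt{not}\ in\_AS(X).$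 Let $\pi(A)=\{\ell\mid in\_AS(\ell)\in A\}$. **Theorem.** Let $\mathcal P=(P,<)$ be a propositional prioritized program. Then (i) if $A\in\mathcal{OAS}(P_{I_{\mathrm{weak}}}\cup F(\mathcal P))$, then $\pi(A)\in w\mathcal{PAS}(\mathcal P)$; and (ii) for each $A\in w\mathcal{PAS}(\mathcal P)$ there exists some $A'\in\mathcal{OAS}(P_{I_{\mathrm{weak}}}\cup F(\mathcal P))$ such that $\pi(A')=A$. -/

import Mathlib

namespace ASP

/-! ## Literals, rules and answer sets of ground programs -/

/-- Classical literals over atoms `A`: `pos a` is `a` and `neg a` is `¬a`. -/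
inductive Literal (A : Type*) where
  | pos (a : A) : Literal A
  | neg (a : A) : Literal A

namespace Literal

/-- The atom underlying a literal. -/
def atom {A : Type*} : Literal A → A
  | pos a => a
  | neg a => a

/-- The complementary literal. -/
def compl {A : Type*} : Literal A → Literal A
  | pos a => neg a
  | neg a => pos a

/-- Apply a function to the underlying atom. -/
def map {A B : Type*} (f : A → B) : Literal A → Literal B
  | pos a => pos (f a)
  | neg a => neg (f a)

end Literal

/-- A rule `h₁ v … v hₙ :- b₁, …, b_k, not b_{k+1}, …, not b_m`. -/
structure Rule (A : Type*) where
  head : List (Literal A)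
  posBody : List (Literal A)
  negBody : List (Literal A)

namespace Rule

/-- Apply a function to all atoms of a rule. -/
def map {A B : Type*} (f : A → B) (r : Rule A) : Rule B where
  head := r.head.map (Literal.map f)
  posBody := r.posBody.map (Literal.map f)
  negBody := r.negBody.map (Literal.map f)

/-- All literals occurring in a rule. -/
def literals {A : Type*} (r : Rule A) : List (Literal A) :=
  r.head ++ r.posBody ++ r.negBody

/-- The rule without its negative body. -/
def dropNeg {A : Type*} (r : Rule A) : Rule A where
  head := r.head
  posBody := r.posBody
  negBody := []

/-- The rule without its positive body. -/
def dropPos {A : Type*} (r : Rule A) : Rule A where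
  head := r.head
  posBody := []
  negBody := r.negBody

end Rule

/-- The set `X` of literals defeats the rule `r`: it meets the negative body of `r`. -/
def Defeats {A : Type*} (X : Set (Literal A)) (r : Rule A) : Prop :=
  ∃ l ∈ r.negBody, l ∈ X

/-- A set of literals is consistent if it contains no complementary pair. -/
def Consistent {A : Type*} (I : Set (Literal A)) : Prop :=
  ∀ l ∈ I, l.compl ∉ I

/-- `I` is closed under the (positive) program `P`. -/
def ClosedUnder {A : Type*} (P : Set (Rule A)) (I : Set (Literal A)) : Prop :=
  ∀ r ∈ P, (∀ l ∈ r.posBody, l ∈ I) → ∃ l ∈ r.head, l ∈ I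

/-- The Gelfond-Lifschitz reduct of `P` with respect to `I`. -/
def reduct {A : Type*} (P : Set (Rule A)) (I : Set (Literal A)) : Set (Rule A) :=
  {g | ∃ r ∈ P, ¬ Defeats I r ∧ g = r.dropNeg}

/-- The (consistent) answer sets of a ground program: `I` is a minimal consistent set of literals
closed under the reduct. Every member of such a minimal set is a head literal of `P`,
so it lies in the Herbrand base automatically. -/
def answerSets {A : Type*} (P : Set (Rule A)) : Set (Set (Literal A)) :=
  {I | Minimal (fun X => Consistent X ∧ ClosedUnder (reduct P I) X) I}

/-- The literals over the atoms occurring in a propositional program. -/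
def literalBase {A : Type*} (P : Set (Rule A)) : Set (Literal A) :=
  {l | ∃ r ∈ P, ∃ l' ∈ r.literals, l'.atom = l.atom}

/-! ## Weak constraints and optimal answer sets of ground programs -/

/-- A weak constraint `:~ b₁, …, b_k, not b_{k+1}, …, not b_m. [weight : level]`. -/
structure WeakConstraint (A : Type*) where
  posBody : List (Literal A)
  negBody : List (Literal A)
  weight : ℕ
  level : ℕ
  one_le_weight : 1 ≤ weight
  one_le_level : 1 ≤ level

namespace WeakConstraint

/-- Apply a function to all atoms of a weak constraint. -/
def map {A B : Type*} (f : A → B) (w : WeakConstraint A) : WeakConstraint B where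
  posBody := w.posBody.map (Literal.map f)
  negBody := w.negBody.map (Literal.map f)
  weight := w.weight
  level := w.level
  one_le_weight := w.one_le_weight
  one_le_level := w.one_le_level

/-- `w` is violated by `I`: its body is true in `I`. -/
def Violated {A : Type*} (w : WeakConstraint A) (I : Set (Literal A)) : Prop :=
  (∀ l ∈ w.posBody, l ∈ I) ∧ ∀ l ∈ w.negBody, l ∉ I

end WeakConstraint

/-- A ground program with weak constraints. -/
structure GroundProgram (A : Type*) where
  rules : Set (Rule A)
  weak : Set (WeakConstraint A)

namespace GroundProgram

/-- The maximum weight of a weak constraint. -/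
noncomputable def wmax {A : Type*} (P : GroundProgram A) : ℕ :=
  sSup (WeakConstraint.weight '' P.weak)

/-- The maximum level of a weak constraint. -/
noncomputable def lmax {A : Type*} (P : GroundProgram A) : ℕ :=
  sSup (WeakConstraint.level '' P.weak)

/-- The level factors `f(1) = 1` and `f(n) = f(n-1) * |WC| * wmax + 1` for `n > 1`.
Levels start at 1; the value at 0 is never used. -/
noncomputable def levelFactor {A : Type*} (P : GroundProgram A) : ℕ → ℕ
  | 0 => 0
  | 1 => 1
  | n + 2 => levelFactor P (n + 1) * P.weak.ncard * P.wmax + 1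

/-- The objective function: the sum over all levels of the level factor times the sum of the
weights of the violated weak constraints of that level. -/
noncomputable def cost {A : Type*} (P : GroundProgram A) (I : Set (Literal A)) : ℕ :=
  ∑ i ∈ Finset.Icc 1 P.lmax,
    P.levelFactor i * ∑ᶠ w ∈ {w | w ∈ P.weak ∧ w.level = i ∧ w.Violated I}, w.weight

/-- The optimal answer sets: answer sets of the part without weak constraints that minimize the
objective function. -/
def optimalAnswerSets {A : Type*} (P : GroundProgram A) : Set (Set (Literal A)) :=
  {I | I ∈ answerSets P.rules ∧ ∀ J ∈ answerSets P.rules, P.cost I ≤ P.cost J}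

end GroundProgram

/-! ## Non-ground (function-free) programs and their grounding -/

/-- Terms over variables `V` and constants `C`. -/
inductive Term (V C : Type*) where
  | var (v : V) : Term V C
  | const (c : C) : Term V C

/-- The constant that a term becomes under a ground substitution. -/
def Term.subst {V C : Type*} (σ : V → C) : Term V C → C
  | .var v => σ v
  | .const c => c

/-- A predicate symbol applied to arguments. -/
structure Atom (S T : Type*) where
  pred : S
  args : List T

/-- Ground instance of an atom. -/
def Atom.subst {S V C : Type*} (σ : V → C) (a : Atom S (Term V C)) : Atom S C where
  pred := a.pred
  args := a.args.map (Term.subst σ)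

/-- Built-in comparisons `s < t` (the built-in total order on constants) and `s != t`. -/
inductive Builtin (T : Type*) where
  | lt (s t : T) : Builtin T
  | ne (s t : T) : Builtin T

namespace Builtin

/-- The terms compared. -/
def terms {T : Type*} : Builtin T → List T
  | lt s t => [s, t]
  | ne s t => [s, t]

/-- Truth of a comparison under a ground substitution. -/
def Holds {V C : Type*} [LinearOrder C] (σ : V → C) : Builtin (Term V C) → Prop
  | lt s t => s.subst σ < t.subst σ
  | ne s t => s.subst σ ≠ t.subst σ

end Builtin

/-- A rule with variables, whose body may also contain built-in comparisons. -/
structure FORule (S V C : Type*) where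
  rule : Rule (Atom S (Term V C))
  builtins : List (Builtin (Term V C))

/-- A weak constraint with variables. -/
abbrev FOWeak (S V C : Type*) := WeakConstraint (Atom S (Term V C))

/-- A program with variables and weak constraints. -/
structure Program (S V C : Type*) where
  rules : Set (FORule S V C)
  weak : Set (FOWeak S V C)

namespace Program

/-- The union of two programs. -/
instance {S V C : Type*} : Union (Program S V C) where
  union P Q := { rules := P.rules ∪ Q.rules, weak := P.weak ∪ Q.weak }

/-- The terms occurring in a rule. -/
def ruleTerms {S V C : Type*} (r : FORule S V C) : List (Term V C) :=
  r.rule.literals.flatMap (fun l => l.atom.args) ++ r.builtins.flatMap Builtin.terms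

/-- The terms occurring in a weak constraint. -/
def weakTerms {S V C : Type*} (w : FOWeak S V C) : List (Term V C) :=
  (w.posBody ++ w.negBody).flatMap (fun l => l.atom.args)

/-- The constants occurring in a program. -/
def constants {S V C : Type*} (P : Program S V C) : Set C :=
  {c | (∃ r ∈ P.rules, Term.const c ∈ ruleTerms r) ∨ ∃ w ∈ P.weak, Term.const c ∈ weakTerms w}

/-- The Herbrand universe: the constants of the program or, if there are none, one arbitrary
constant. -/
def herbrandUniverse {S V C : Type*} [Nonempty C] (P : Program S V C) : Set C :=
  {c | c ∈ P.constants ∨ (P.constants = ∅ ∧ c = Classical.arbitrary C)}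

/-- The ground instantiation over the Herbrand universe. The built-in comparisons are evaluated:
instances with a false comparison are dropped, true comparisons are erased. -/
def ground {S V C : Type*} [LinearOrder C] [Nonempty C] (P : Program S V C) :
    GroundProgram (Atom S C) where
  rules := {g | ∃ r ∈ P.rules, ∃ σ : V → C, (∀ v, σ v ∈ P.herbrandUniverse) ∧
    (∀ b ∈ r.builtins, b.Holds σ) ∧ g = r.rule.map (Atom.subst σ)}
  weak := {g | ∃ w ∈ P.weak, ∃ σ : V → C, (∀ v, σ v ∈ P.herbrandUniverse) ∧
    g = w.map (Atom.subst σ)}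

/-- Optimal answer sets of a program with variables: those of its ground instantiation. -/
def optimalAnswerSets {S V C : Type*} [LinearOrder C] [Nonempty C] (P : Program S V C) :
    Set (Set (Literal (Atom S C))) :=
  P.ground.optimalAnswerSets

end Program

/-! ## Prioritized programs and B-preferred answer sets -/

/-- A prioritized propositional program `(P, <)`: a finite set of normal rules that are not
constraints, with a strict partial order on it; `lt r s` says that `r` has higher priority. -/
@[ext]
structure PrioritizedProgram (α : Type*) where
  rules : Set (Rule α)
  lt : Rule α → Rule α → Prop
  finite : rules.Finite
  normal : ∀ r ∈ rules, ∃ c, r.head = [c]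
  lt_mem : ∀ r s, lt r s → r ∈ rules ∧ s ∈ rules
  irrefl : ∀ r, ¬ lt r r
  trans : ∀ r s t, lt r s → lt s t → lt r t

namespace PrioritizedProgram

variable {α : Type*}

/-- The full prioritizations of `P`: the same rules with a total order refining that of `P`. -/
def fullPrioritizations (P : PrioritizedProgram α) : Set (PrioritizedProgram α) :=
  {Q | Q.rules = P.rules ∧ (∀ r s, P.lt r s → Q.lt r s) ∧
    ∀ r ∈ Q.rules, ∀ s ∈ Q.rules, r ≠ s → Q.lt r s ∨ Q.lt s r}

/-- `P` is fully prioritized if it is its only full prioritization. -/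
def FullyPrioritized (P : PrioritizedProgram α) : Prop :=
  P.fullPrioritizations = {P}

/-- The list `l = [r₁, …, rₙ]` enumerates the rules of `P` in increasing order. -/
def Enumerates (P : PrioritizedProgram α) (l : List (Rule α)) : Prop :=
  (∀ r, r ∈ l ↔ r ∈ P.rules) ∧ l.Pairwise P.lt

open Classical in
/-- One step `S_{i-1} ↦ S_i` of the construction that processes the rules by priority. -/
noncomputable def step (S T : Set (Literal α)) (r : Rule α) : Set (Literal α) :=
  if Defeats T r ∨ ((∀ l ∈ r.head, l ∈ S) ∧ Defeats S r) then T else T ∪ {l | l ∈ r.head}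

/-- The last set `S_n` of the sequence `S_0 = ∅, S_1, …, S_n` for `l = [r₁, …, rₙ]`. -/
noncomputable def lastStage (S : Set (Literal α)) (l : List (Rule α)) : Set (Literal α) :=
  l.foldl (step S) ∅

open Classical in
/-- The operator `C_P(S)`, where `l` is the ordered enumeration of the rules of `P`. -/
noncomputable def prefOperator (P : PrioritizedProgram α) (l : List (Rule α))
    (S : Set (Literal α)) : Set (Literal α) :=
  if Consistent (lastStage S l) then lastStage S l else literalBase P.rules

/-- B-preferred answer sets of a fully prioritized and prerequisite-free program:
answer sets `A` with `C_P(A) = A`. -/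
def bPreferredPrereqFree (P : PrioritizedProgram α) : Set (Set (Literal α)) :=
  {A | A ∈ answerSets P.rules ∧ ∃ l, P.Enumerates l ∧ P.prefOperator l A = A}

/-- `r` is a rule of `P` with positive body in `X` that yields `r'` when its positive body is
deleted. -/
def IsSource (P : PrioritizedProgram α) (X : Set (Literal α)) (r' r : Rule α) : Prop :=
  r ∈ P.rules ∧ (∀ l ∈ r.posBody, l ∈ X) ∧ r.dropPos = r'

/-- `r` is the first source of `r'`. -/
def IsFirstSource (P : PrioritizedProgram α) (X : Set (Literal α)) (r' r : Rule α) : Prop :=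
  P.IsSource X r' r ∧ ∀ s, P.IsSource X r' s → s = r ∨ P.lt r s

theorem IsFirstSource.unique {P : PrioritizedProgram α} {X : Set (Literal α)} {r' r s : Rule α}
    (hr : P.IsFirstSource X r' r) (hs : P.IsFirstSource X r' s) : r = s := by
  rcases hr.2 s hs.1 with h | h
  · exact h.symm
  · rcases hs.2 r hr.1 with h' | h'
    · exact h'
    · exact absurd (P.trans _ _ _ h h') (P.irrefl _)

/-- The dual reduct of `P` with respect to `X`: delete the rules whose positive body is not
contained in `X`, delete the positive bodies of the others, and compare the resulting rules
through their first sources. -/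
def dualReduct (P : PrioritizedProgram α) (X : Set (Literal α)) : PrioritizedProgram α where
  rules := {r' | ∃ r, P.IsSource X r' r}
  lt r' s' := ∃ r s, P.IsFirstSource X r' r ∧ P.IsFirstSource X s' s ∧ P.lt r s
  finite := by
    refine (P.finite.image Rule.dropPos).subset ?_
    rintro r' ⟨r, hr, -, rfl⟩
    exact ⟨r, hr, rfl⟩
  normal := by
    rintro r' ⟨r, hr, -, rfl⟩
    exact P.normal r hr
  lt_mem := by
    rintro r' s' ⟨r, s, hr, hs, -⟩
    exact ⟨⟨r, hr.1⟩, ⟨s, hs.1⟩⟩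
  irrefl := by
    rintro r' ⟨r, s, hr, hs, h⟩
    obtain rfl := hr.unique hs
    exact P.irrefl _ h
  trans := by
    rintro r' s' t' ⟨r, s, hr, hs, h⟩ ⟨u, t, hu, ht, h'⟩
    obtain rfl := hs.unique hu
    exact ⟨r, t, hr, ht, P.trans _ _ _ h h'⟩

/-- B-preferred answer sets of a fully prioritized program. -/
def bPreferredFull (P : PrioritizedProgram α) : Set (Set (Literal α)) :=
  {A | A ∈ answerSets P.rules ∧ A ∈ (P.dualReduct A).bPreferredPrereqFree}

/-- B-preferred answer sets of a prioritized program. -/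
def bPreferred (P : PrioritizedProgram α) : Set (Set (Literal α)) :=
  {A | A ∈ answerSets P.rules ∧
    ((P.FullyPrioritized ∧ A ∈ P.bPreferredFull) ∨
      (¬ P.FullyPrioritized ∧ ∃ Q ∈ P.fullPrioritizations, A ∈ Q.bPreferredFull))}

/-! ## Weakly preferred answer sets -/

/-- The distance of the orders of `P` and `Q`: the number of pairs of rules that are ordered in
opposite ways. -/
noncomputable def distance (P Q : PrioritizedProgram α) : ℕ :=
  {p : Rule α × Rule α | P.lt p.1 p.2 ∧ Q.lt p.2 p.1}.ncard

/-- The preference violation degree of an answer set `A`: the minimum distance from a full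
prioritization of `P` to a fully prioritized program on the same rules for which `A` is
B-preferred. (For an answer set `A` the set of distances is never empty: one may put the rules
applied in `A` first.) -/
noncomputable def violationDegree (P : PrioritizedProgram α) (A : Set (Literal α)) : ℕ :=
  sInf {n | ∃ P₁ ∈ P.fullPrioritizations, ∃ P₂ : PrioritizedProgram α,
    P₂.rules = P.rules ∧ P₂.FullyPrioritized ∧ A ∈ P₂.bPreferred ∧ n = distance P₁ P₂}

/-- The preference violation degree of a prioritized program: the minimum over its answer
sets. -/
noncomputable def programViolationDegree (P : PrioritizedProgram α) : ℕ :=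
  sInf {n | ∃ A ∈ answerSets P.rules, n = P.violationDegree A}

/-- The weakly preferred answer sets: the answer sets of least preference violation degree. -/
def weaklyPreferred (P : PrioritizedProgram α) : Set (Set (Literal α)) :=
  {A | A ∈ answerSets P.rules ∧ P.violationDegree A = P.programViolationDegree}

end PrioritizedProgram

/-! ## The meta-interpreter -/

/-- The predicate symbols of the meta-interpreter. -/
inductive MetaPred where
  | rule | head | pbl | nbl | compl
  | in_AS | pos_body_exists | pos_body_true | pbl_inbetween | pbl_notlast | pbl_notfirst
  | pos_body_true_upto | neg_body_false
  | pr | pr1 | lit | defeat_local | defeat_global | in_CP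

/-- The variables of the meta-interpreter. -/
inductive MetaVar where
  | X | Y | Z | R | Y1

/-- Terms of the meta-interpreter over constants `C`. -/
abbrev MetaTerm (C : Type*) := Term MetaVar C

/-- Rules of the meta-interpreter. -/
abbrev MetaRule (C : Type*) := FORule MetaPred MetaVar C

/-- The positive literal `p(ts)`. -/
def lit {T : Type*} (p : MetaPred) (ts : List T) : Literal (Atom MetaPred T) :=
  .pos { pred := p, args := ts }

section

variable {C : Type*}

/-- The variable `X` as a term. -/
abbrev vX : MetaTerm C := .var .X
/-- The variable `Y` as a term. -/
abbrev vY : MetaTerm C := .var .Y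
/-- The variable `Z` as a term. -/
abbrev vZ : MetaTerm C := .var .Z
/-- The variable `R` as a term. -/
abbrev vR : MetaTerm C := .var .R
/-- The variable `Y1` as a term. -/
abbrev vY1 : MetaTerm C := .var .Y1

/-- The rule with head `h`, positive body `b`, negative body `n` and comparisons `cs`. -/
abbrev mk (h b n : List (Literal (Atom MetaPred (MetaTerm C))))
    (cs : List (Builtin (MetaTerm C))) : MetaRule C where
  rule := { head := h, posBody := b, negBody := n }
  builtins := cs

/-- The basic meta-interpreter, which represents answer sets. -/
def basicRules (C : Type*) : List (MetaRule C) := [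
  -- in_AS(X) :- head(X,R), pos_body_true(R), not neg_body_false(R).
  mk [lit .in_AS [vX]] [lit .head [vX, vR], lit .pos_body_true [vR]]
    [lit .neg_body_false [vR]] [],
  -- pos_body_exists(R) :- pbl(X,R).
  mk [lit .pos_body_exists [vR]] [lit .pbl [vX, vR]] [] [],
  -- pos_body_true(R) :- rule(R), not pos_body_exists(R).
  mk [lit .pos_body_true [vR]] [lit .rule [vR]] [lit .pos_body_exists [vR]] [],
  -- pbl_inbetween(X,Y,R) :- pbl(X,R), pbl(Y,R), pbl(Z,R), X < Z, Z < Y.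
  mk [lit .pbl_inbetween [vX, vY, vR]]
    [lit .pbl [vX, vR], lit .pbl [vY, vR], lit .pbl [vZ, vR]] [] [.lt vX vZ, .lt vZ vY],
  -- pbl_notlast(X,R) :- pbl(X,R), pbl(Y,R), X < Y.
  mk [lit .pbl_notlast [vX, vR]] [lit .pbl [vX, vR], lit .pbl [vY, vR]] [] [.lt vX vY],
  -- pbl_notfirst(X,R) :- pbl(X,R), pbl(Y,R), Y < X.
  mk [lit .pbl_notfirst [vX, vR]] [lit .pbl [vX, vR], lit .pbl [vY, vR]] [] [.lt vY vX],
  -- pos_body_true_upto(R,X) :- pbl(X,R), not pbl_notfirst(X,R), in_AS(X).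
  mk [lit .pos_body_true_upto [vR, vX]] [lit .pbl [vX, vR], lit .in_AS [vX]]
    [lit .pbl_notfirst [vX, vR]] [],
  -- pos_body_true_upto(R,X) :- pos_body_true_upto(R,Y), pbl(X,R), in_AS(X), Y < X,
  --                            not pbl_inbetween(Y,X,R).
  mk [lit .pos_body_true_upto [vR, vX]]
    [lit .pos_body_true_upto [vR, vY], lit .pbl [vX, vR], lit .in_AS [vX]]
    [lit .pbl_inbetween [vY, vX, vR]] [.lt vY vX],
  -- pos_body_true(R) :- pos_body_true_upto(R,X), not pbl_notlast(X,R).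
  mk [lit .pos_body_true [vR]] [lit .pos_body_true_upto [vR, vX]]
    [lit .pbl_notlast [vX, vR]] [],
  -- neg_body_false(Y) :- nbl(X,Y), in_AS(X).
  mk [lit .neg_body_false [vY]] [lit .nbl [vX, vY], lit .in_AS [vX]] [] [],
  -- :- compl(X,Y), in_AS(X), in_AS(Y).
  mk [] [lit .compl [vX, vY], lit .in_AS [vX], lit .in_AS [vY]] [] []]

/-- The rules that guess the two total orders and check preferredness. -/
def preferenceRules (C : Type*) : List (MetaRule C) := [
  -- pr(X,Y) v pr(Y,X) :- rule(X), rule(Y), X != Y.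
  mk [lit .pr [vX, vY], lit .pr [vY, vX]] [lit .rule [vX], lit .rule [vY]] [] [.ne vX vY],
  -- pr(X,Z) :- pr(X,Y), pr(Y,Z).
  mk [lit .pr [vX, vZ]] [lit .pr [vX, vY], lit .pr [vY, vZ]] [] [],
  -- :- pr(X,X).
  mk [] [lit .pr [vX, vX]] [] [],
  -- pr1(X,Y) v pr1(Y,X) :- rule(X), rule(Y), X != Y.
  mk [lit .pr1 [vX, vY], lit .pr1 [vY, vX]] [lit .rule [vX], lit .rule [vY]] [] [.ne vX vY],
  -- pr1(X,Z) :- pr1(X,Y), pr1(Y,Z).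
  mk [lit .pr1 [vX, vZ]] [lit .pr1 [vX, vY], lit .pr1 [vY, vZ]] [] [],
  -- :- pr1(X,X).
  mk [] [lit .pr1 [vX, vX]] [] [],
  -- lit(X,Y) :- head(X,Y), pos_body_true(Y), not defeat_local(Y), not in_AS(X).
  mk [lit .lit [vX, vY]] [lit .head [vX, vY], lit .pos_body_true [vY]]
    [lit .defeat_local [vY], lit .in_AS [vX]] [],
  -- lit(X,Y) :- head(X,Y), pos_body_true(Y), not defeat_local(Y), not defeat_global(Y).
  mk [lit .lit [vX, vY]] [lit .head [vX, vY], lit .pos_body_true [vY]]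
    [lit .defeat_local [vY], lit .defeat_global [vY]] [],
  -- defeat_local(Y) :- nbl(X,Y), lit(X,Y1), pr1(Y1,Y).
  mk [lit .defeat_local [vY]] [lit .nbl [vX, vY], lit .lit [vX, vY1], lit .pr1 [vY1, vY]] [] [],
  -- defeat_global(Y) :- nbl(X,Y), in_AS(X).
  mk [lit .defeat_global [vY]] [lit .nbl [vX, vY], lit .in_AS [vX]] [] [],
  -- in_CP(X) :- lit(X,Y).
  mk [lit .in_CP [vX]] [lit .lit [vX, vY]] [] [],
  -- :- in_CP(X), not in_AS(X).
  mk [] [lit .in_CP [vX]] [lit .in_AS [vX]] []]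

/-- The weak constraint `:~ rule(X), rule(Y), pr(X,Y), pr1(Y,X). [1:1]`. -/
def inversionPenalty (C : Type*) : FOWeak MetaPred MetaVar C where
  posBody := [lit .rule [vX], lit .rule [vY], lit .pr [vX, vY], lit .pr1 [vY, vX]]
  negBody := []
  weight := 1
  level := 1
  one_le_weight := le_rfl
  one_le_level := le_rfl

/-- The meta-interpreter for weakly preferred answer sets. -/
def weakMetaInterpreter (C : Type*) : Program MetaPred MetaVar C where
  rules := {r | r ∈ basicRules C ++ preferenceRules C}
  weak := {inversionPenalty C}

/-- The fact `p(cs).` -/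
def fact (p : MetaPred) (cs : List C) : MetaRule C :=
  mk [lit p (cs.map Term.const)] [] [] []

/-- The facts `F(P)` representing `P = (P, <)`, where `litName` and `ruleName` give the constants
that stand for the literals and for the rules. The facts `pr(r,s)` are those for the transitive
reduction of `<`; for a finite strict partial order this is the covering relation. -/
def representation {α : Type*} (P : PrioritizedProgram α) (litName : Literal α → C)
    (ruleName : Rule α → C) : Program MetaPred MetaVar C where
  rules :=
    {f | ∃ r ∈ P.rules, f = fact .rule [ruleName r]} ∪
    {f | ∃ r ∈ P.rules, ∃ l ∈ r.head, f = fact .head [litName l, ruleName r]} ∪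
    {f | ∃ r ∈ P.rules, ∃ l ∈ r.posBody, f = fact .pbl [litName l, ruleName r]} ∪
    {f | ∃ r ∈ P.rules, ∃ l ∈ r.negBody, f = fact .nbl [litName l, ruleName r]} ∪
    {f | ∃ a, (∃ r ∈ P.rules, Literal.pos a ∈ r.literals) ∧
      (∃ r ∈ P.rules, Literal.neg a ∈ r.literals) ∧
      f = fact .compl [litName (.pos a), litName (.neg a)]} ∪
    {f | ∃ r s, P.lt r s ∧ (¬ ∃ t, P.lt r t ∧ P.lt t s) ∧
      f = fact .pr [ruleName r, ruleName s]}
  weak := ∅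

/-- The projection `π(A) = {ℓ | in_AS(ℓ) ∈ A}`. -/
def projection {α : Type*} (litName : Literal α → C) (A : Set (Literal (Atom MetaPred C))) :
    Set (Literal α) :=
  {l | lit .in_AS [litName l] ∈ A}

end

end ASP

/-! ### Answer sets as minimal closed sets -/

namespace ASP

/-! The answer sets of the meta-interpreter amount to triples: an answer set `A` of the program, a
total order `pr` refining the given priorities, and a total order `pr1` for which `A` is
B-preferred. The weak constraint has one violated instance for each pair of rules that the two
orders arrange in opposite ways, so the cost of the triple is the distance of its orders. For fixed
`A` the least such cost is the violation degree of `A`. Hence minimizing the cost over all triples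
selects exactly the answer sets of least violation degree, which is the claim.

On the side of prioritized programs, the staged operator is replaced by a local condition. By
`mem_bPreferred_iff`, an answer set `A` is B-preferred for a total order iff every rule whose
positive body is true and whose head is false in `A` has in its negative body the head of a
higher-ranked rule whose whole body is true in `A` (`RespectsPriorities`). This is what `lit`,
`defeat_local` and `in_CP` check. Also, every answer set is B-preferred for some total order
(`exists_total_mem_bPreferred`), so violation degrees are attained.

On the side of the meta-interpreter, every predicate gets an explicit interpretation (`Interp`), in
which positive bodies are evaluated in a set `B` that may differ from the set `A` used for negation.
Minimality of an answer set `I` bounds it by this interpretation for each suitable `B`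
(`subset_model`). Taking `B` to be the projection of `I` identifies the auxiliary predicates; taking
`B` closed under the reduct of the object program shows that the projection is a minimal closed set.
Conversely, the interpretation built from `A` and two orders is an answer set
(`model_mem_answerSets`). The cost is computed in `cost_eq_distance`. -/

theorem closedUnder_reduct_iff {A : Type*} {P : Set (Rule A)} {I J : Set (Literal A)} :
    ClosedUnder (reduct P I) J ↔
      ∀ r ∈ P, ¬ Defeats I r → (∀ l ∈ r.posBody, l ∈ J) → ∃ l ∈ r.head, l ∈ J := by
  constructor
  · intro h r hr hd hp
    exact h r.dropNeg ⟨r, hr, hd, rfl⟩ hp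
  · rintro h g ⟨r, hr, hd, rfl⟩ hp
    exact h r hr hd hp

theorem Consistent.mono {A : Type*} {I J : Set (Literal A)} (h : Consistent I) (hJ : J ⊆ I) :
    Consistent J :=
  fun l hl hc => h l (hJ hl) (hJ hc)

/-- Consistency passes to subsets, so once `I` is consistent, minimality has to be tested only
against closed subsets, with no consistency requirement. -/
theorem mem_answerSets_iff {A : Type*} {P : Set (Rule A)} {I : Set (Literal A)} :
    I ∈ answerSets P ↔ Consistent I ∧ ClosedUnder (reduct P I) I ∧
      ∀ J ⊆ I, ClosedUnder (reduct P I) J → I ⊆ J := by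
  constructor
  · rintro ⟨⟨h1, h2⟩, h3⟩
    exact ⟨h1, h2, fun J hJ hc => h3 ⟨h1.mono hJ, hc⟩ hJ⟩
  · rintro ⟨h1, h2, h3⟩
    exact ⟨⟨h1, h2⟩, fun J hJ hle => h3 J hle hJ.2⟩

/-- The rule `r` generates a literal of the answer set `A`: its body is true in `A`. -/
def Generating {α : Type*} (A : Set (Literal α)) (r : Rule α) : Prop :=
  (∀ l ∈ r.posBody, l ∈ A) ∧ ¬ Defeats A r

/-! ### Generating rules, total orders and first sources -/

namespace PrioritizedProgram

variable {α : Type*} {P Q : PrioritizedProgram α} {A : Set (Literal α)}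

theorem mem_of_mem_head (hA : A ∈ answerSets P.rules) {r : Rule α} (hr : r ∈ P.rules)
    (hg : Generating A r) {l : Literal α} (hl : l ∈ r.head) : l ∈ A := by
  obtain ⟨k, hk, hkA⟩ := closedUnder_reduct_iff.1 (mem_answerSets_iff.1 hA).2.1 r hr hg.2 hg.1
  obtain ⟨c, hc⟩ := P.normal r hr
  simp only [hc, List.mem_singleton] at hk hl
  rw [hl, ← hk]; exact hkA

/-- The heads of the generating rules form a subset of `A` closed under the reduct, so minimality
makes it all of `A`. -/
theorem exists_generating (hA : A ∈ answerSets P.rules) {l : Literal α} (hl : l ∈ A) :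
    ∃ r ∈ P.rules, Generating A r ∧ l ∈ r.head := by
  have h := (mem_answerSets_iff.1 hA).2.2 {l | ∃ r ∈ P.rules, Generating A r ∧ l ∈ r.head} ?_ ?_
  · exact h hl
  · rintro k ⟨r, hr, hg, hk⟩
    exact mem_of_mem_head hA hr hg hk
  · rw [closedUnder_reduct_iff]
    intro r hr hd hp
    obtain ⟨c, hc⟩ := P.normal r hr
    refine ⟨c, by simp [hc], r, hr, ⟨fun k hk => ?_, hd⟩, by simp [hc]⟩
    obtain ⟨s, hs, hg, hk'⟩ := hp k hk
    exact mem_of_mem_head hA hs hg hk'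

/-- The rules of the dual reduct have no positive body, so a set closed under their reduct contains
the heads of all generating rules and hence `A`. Thus the first requirement on a B-preferred answer
set is automatic, and only the fixpoint equation has content. -/
theorem mem_answerSets_dualReduct (hA : A ∈ answerSets P.rules) :
    A ∈ answerSets (P.dualReduct A).rules := by
  refine mem_answerSets_iff.2 ⟨(mem_answerSets_iff.1 hA).1, ?_, ?_⟩
  · rw [closedUnder_reduct_iff]
    rintro _ ⟨r, hr, hp, rfl⟩ hd -
    obtain ⟨c, hc⟩ := P.normal r hr
    have : c ∈ r.head := by simp [hc]
    exact ⟨c, this, mem_of_mem_head hA hr ⟨hp, hd⟩ this⟩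
  · intro J hJ hc l hl
    rw [closedUnder_reduct_iff] at hc
    obtain ⟨r, hr, hg, hlr⟩ := exists_generating hA hl
    obtain ⟨k, hk, hkJ⟩ := hc r.dropPos ⟨r, hr, hg.1, rfl⟩ hg.2 (by simp [Rule.dropPos])
    obtain ⟨c, hc⟩ := P.normal r hr
    simp only [Rule.dropPos, hc, List.mem_singleton] at hk hlr
    rw [hlr, ← hk]; exact hkJ

/-- The order of `P` is total. -/
def Total (P : PrioritizedProgram α) : Prop :=
  ∀ r ∈ P.rules, ∀ s ∈ P.rules, r ≠ s → P.lt r s ∨ P.lt s r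

theorem asymm (P : PrioritizedProgram α) {r s : Rule α} (h : P.lt r s) : ¬ P.lt s r :=
  fun h' => P.irrefl _ (P.trans _ _ _ h h')

theorem fullyPrioritized_iff : P.FullyPrioritized ↔ P.Total := by
  constructor
  · intro h
    have : P ∈ P.fullPrioritizations := by rw [h]; rfl
    exact this.2.2
  · intro h
    ext Q
    constructor
    · rintro ⟨h1, h2, h3⟩
      rw [Set.mem_singleton_iff]
      ext r s
      · rw [h1]
      · refine ⟨fun hq => ?_, h2 r s⟩
        have hm := Q.lt_mem _ _ hq
        rw [h1] at hm
        rcases h r hm.1 s hm.2 (by rintro rfl; exact Q.irrefl _ hq) with h' | h'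
        · exact h'
        · exact absurd (h2 _ _ h') (Q.asymm hq)
    · rintro rfl
      exact ⟨rfl, fun _ _ h => h, h⟩

theorem fullPrioritizations_nonempty (P : PrioritizedProgram α) :
    P.fullPrioritizations.Nonempty := by
  have : IsPartialOrder (Rule α) (fun r s => r = s ∨ P.lt r s) :=
    { refl := fun r => Or.inl rfl
      trans := by
        rintro r s t (rfl | h) (rfl | h')
        · exact Or.inl rfl
        · exact Or.inr h'
        · exact Or.inr h
        · exact Or.inr (P.trans _ _ _ h h')
      antisymm := by
        rintro r s (rfl | h) (h' | h')
        · rfl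
        · rfl
        · exact h'.symm
        · exact absurd h' (P.asymm h) }
  -- Szpilrajn's extension gives a linear order on all rules; its strict part is then restricted to
  -- the rules of `P`.
  obtain ⟨R, hR, hle⟩ := extend_partialOrder (fun r s => r = s ∨ P.lt r s)
  refine ⟨{ rules := P.rules
            lt := fun r s => r ∈ P.rules ∧ s ∈ P.rules ∧ R r s ∧ r ≠ s
            finite := P.finite
            normal := P.normal
            lt_mem := fun r s h => ⟨h.1, h.2.1⟩
            irrefl := fun r h => h.2.2.2 rfl
            trans := ?_ }, rfl, ?_, ?_⟩
  · rintro r s t ⟨h1, h2, h3, h4⟩ ⟨h5, h6, h7, h8⟩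
    refine ⟨h1, h6, hR.trans _ _ _ h3 h7, ?_⟩
    rintro rfl
    exact h4 (hR.antisymm _ _ h3 h7)
  · intro r s h
    refine ⟨(P.lt_mem _ _ h).1, (P.lt_mem _ _ h).2, hle _ _ (Or.inr h), ?_⟩
    rintro rfl
    exact P.irrefl _ h
  · intro r hr s hs hne
    rcases hR.total r s with h | h
    · exact Or.inl ⟨hr, hs, h, hne⟩
    · exact Or.inr ⟨hs, hr, h, hne.symm⟩

theorem exists_enumerates (hP : P.Total) : ∃ l, P.Enumerates l := by
  classical
  suffices H : ∀ s : Finset (Rule α), (∀ r ∈ s, r ∈ P.rules) →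
      ∃ l : List (Rule α), (∀ r, r ∈ l ↔ r ∈ s) ∧ l.Pairwise P.lt by
    obtain ⟨l, hl, hl'⟩ := H P.finite.toFinset (by simp)
    exact ⟨l, by simpa using hl, hl'⟩
  intro s
  induction s using Finset.strongInduction with
  | H s ih =>
    intro hs
    rcases s.eq_empty_or_nonempty with rfl | hne
    · exact ⟨[], by simp, List.Pairwise.nil⟩
    · have : IsStrictOrder (Rule α) P.lt := { irrefl := P.irrefl, trans := P.trans }
      obtain ⟨m, hm, hmin⟩ := (s.finite_toSet.wellFoundedOn (r := P.lt)).has_min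
        Set.univ ⟨⟨_, hne.choose_spec⟩, trivial⟩
      obtain ⟨l, hl, hl'⟩ := ih (s.erase m) (Finset.erase_ssubset m.2)
        (fun r hr => hs r (Finset.mem_of_mem_erase hr))
      refine ⟨m :: l, fun r => ?_, List.pairwise_cons.2 ⟨fun r hr => ?_, hl'⟩⟩
      · rw [List.mem_cons, hl, Finset.mem_erase]
        constructor
        · rintro (rfl | h)
          · exact m.2
          · exact h.2
        · intro h
          by_cases hrm : r = m
          · exact Or.inl hrm
          · exact Or.inr ⟨hrm, h⟩
      · rw [hl, Finset.mem_erase] at hr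
        rcases hP m (hs m m.2) r (hs r hr.2) (Ne.symm hr.1) with h | h
        · exact h
        · exact absurd h (hmin ⟨r, hr.2⟩ trivial)

/-- The sources of a rule form a finite nonempty set, which has a least element in a total order.
The last conjunct allows a source to be exchanged for the first source without losing priority. -/
theorem exists_isFirstSource (hP : P.Total) {r : Rule α} (hr : r ∈ P.rules)
    (hp : ∀ l ∈ r.posBody, l ∈ A) :
    ∃ s, P.IsFirstSource A r.dropPos s ∧ (s = r ∨ P.lt s r) := by
  have : IsStrictOrder (Rule α) P.lt := { irrefl := P.irrefl, trans := P.trans }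
  have hfin : {s | P.IsSource A r.dropPos s}.Finite := P.finite.subset fun s hs => hs.1
  obtain ⟨m, -, hmin⟩ := (hfin.wellFoundedOn (r := P.lt)).has_min
        Set.univ ⟨⟨r, hr, hp, rfl⟩, trivial⟩
  have key : ∀ s, P.IsSource A r.dropPos s → s = m ∨ P.lt m s := by
    intro s hs
    by_cases h : s = m
    · exact Or.inl h
    · rcases hP m m.2.1 s hs.1 (Ne.symm h) with h | h
      · exact Or.inr h
      · exact absurd h (hmin ⟨s, hs⟩ trivial)
  refine ⟨m, ⟨m.2, key⟩, ?_⟩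
  rcases key r ⟨hr, hp, rfl⟩ with h | h
  · exact Or.inl h.symm
  · exact Or.inr h

theorem dualReduct_total (hP : P.Total) : (P.dualReduct A).Total := by
  rintro _ ⟨r, hr, hpr, rfl⟩ _ ⟨s, hs, hps, rfl⟩ hne
  obtain ⟨r', hr', -⟩ := exists_isFirstSource hP hr hpr
  obtain ⟨s', hs', -⟩ := exists_isFirstSource hP hs hps
  rcases hP r' hr'.1.1 s' hs'.1.1 (by
    rintro rfl
    exact hne (hr'.1.2.2.symm.trans hs'.1.2.2)) with h | h
  · exact Or.inl ⟨r', s', hr', hs', h⟩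
  · exact Or.inr ⟨s', r', hs', hr', h⟩

/-! ### B-preferredness as a local condition on priorities -/

/-- Every rule with positive body true in `A` and head false in `A` is defeated by the head of a
generating rule of higher priority. -/
def RespectsPriorities (P : PrioritizedProgram α) (A : Set (Literal α)) : Prop :=
  ∀ r ∈ P.rules, (∀ l ∈ r.posBody, l ∈ A) → (∀ l ∈ r.head, l ∉ A) →
    ∃ s, P.lt s r ∧ Generating A s ∧ ∃ l ∈ s.head, l ∈ r.negBody

theorem subset_step (S T : Set (Literal α)) (r : Rule α) : T ⊆ step S T r := by
  unfold step
  split_ifs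
  · exact subset_rfl
  · exact Set.subset_union_left

theorem subset_foldl_step (S : Set (Literal α)) (l : List (Rule α)) (T : Set (Literal α)) :
    T ⊆ l.foldl (step S) T := by
  induction l generalizing T with
  | nil => exact subset_rfl
  | cons r l ih => exact (subset_step S T r).trans (ih _)

/-- Of the two reasons for skipping a rule, the second does not depend on the current stage, so its
failure can be remembered for each rule that contributed a literal. -/
theorem exists_of_mem_foldl_step {S T : Set (Literal α)} {l : List (Rule α)} {x : Literal α}
    (hx : x ∈ l.foldl (step S) T) :
    x ∈ T ∨ ∃ r ∈ l, x ∈ r.head ∧ ¬ ((∀ k ∈ r.head, k ∈ S) ∧ Defeats S r) := by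
  induction l generalizing T with
  | nil => exact Or.inl hx
  | cons r l ih =>
    rcases ih hx with h | ⟨s, hs, h⟩
    · unfold step at h
      split_ifs at h with hc
      · exact Or.inl h
      · rcases h with h | h
        · exact Or.inl h
        · exact Or.inr ⟨r, by simp, h, fun h' => hc (Or.inr h')⟩
    · exact Or.inr ⟨s, by simp [hs], h⟩

/-- In the inconsistent case the operator returns all literals over the atoms present. An
inconsistent last stage is nonempty, so some atom is present, and both of its literals would lie in
the consistent set `A`. -/
theorem lastStage_eq_of_prefOperator_eq {l : List (Rule α)} (hl : P.Enumerates l)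
    (hA : Consistent A) (h : P.prefOperator l A = A) : lastStage A l = A := by
  unfold prefOperator at h
  split_ifs at h with hc
  · exact h
  · exfalso
    unfold Consistent at hc
    push Not at hc
    obtain ⟨x, hx, -⟩ := hc
    rcases exists_of_mem_foldl_step hx with h' | ⟨r, hr, hxr, -⟩
    · exact h'
    · have hmem : ∀ y : Literal α, y.atom = x.atom → y ∈ A := by
        intro y hy
        rw [← h]
        exact ⟨r, (hl.1 r).1 hr, x, by simp [Rule.literals, hxr], hy.symm⟩
      exact hA x (hmem x rfl) (hmem _ (by cases x <;> rfl))

theorem respectsPriorities_of_prefOperator_eq (hA : A ∈ answerSets P.rules)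
    {l : List (Rule α)} (hl : (P.dualReduct A).Enumerates l)
    (h : (P.dualReduct A).prefOperator l A = A) : P.RespectsPriorities A := by
  have hlast := lastStage_eq_of_prefOperator_eq hl (mem_answerSets_iff.1 hA).1 h
  intro r hr hp hh
  have hrl : r.dropPos ∈ l := (hl.1 _).2 ⟨r, hr, hp, rfl⟩
  obtain ⟨l₁, l₂, rfl⟩ := List.append_of_mem hrl
  obtain ⟨c, hc⟩ := P.normal r hr
  have hcr : c ∈ r.head := by simp [hc]
  unfold lastStage at hlast
  rw [List.foldl_append, List.foldl_cons] at hlast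
  set T := l₁.foldl (step A) ∅ with hT
  have hsub : step A T r.dropPos ⊆ A := by
    conv_rhs => rw [← hlast]
    exact subset_foldl_step _ _ _
  -- The stages never leave `A`, so a rule with head outside `A` must be skipped. Being defeated by
  -- `A` is no reason to skip it, since that requires the head to be in `A`; so the current stage
  -- defeats it.
  have hdef : Defeats T r := by
    by_contra hd
    have hn : ¬ (Defeats T r.dropPos ∨
        ((∀ l ∈ r.dropPos.head, l ∈ A) ∧ Defeats A r.dropPos)) := by
      rintro (h' | h')
      · exact hd h'
      · exact hh c hcr (h'.1 c hcr)
    unfold step at hsub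
    rw [if_neg hn] at hsub
    exact hh c hcr (hsub (Or.inr hcr))
  obtain ⟨x, hxr, hxT⟩ := hdef
  have hxA : x ∈ A := hsub (subset_step _ _ _ hxT)
  rcases exists_of_mem_foldl_step hxT with h' | ⟨s', hs', hxs, hns⟩
  · exact absurd h' (by simp)
  · have hlt := (List.pairwise_append.1 hl.2).2.2 s' hs' r.dropPos (by simp)
    obtain ⟨s, r₀, hs, hr₀, hsr⟩ := hlt
    obtain ⟨d, hd⟩ := P.normal s hs.1.1
    have hxs' : x ∈ s.head := by
      rw [← hs.1.2.2] at hxs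
      exact hxs
    -- The rule `s'` contributed its only head literal, which is in `A`; had `A` defeated it, it
    -- would have been skipped.
    refine ⟨s, ?_, ⟨hs.1.2.1, fun hd' => hns ⟨fun k hk => ?_, ?_⟩⟩, x, hxs', hxr⟩
    · rcases hr₀.2 r ⟨hr, hp, rfl⟩ with rfl | h'
      · exact hsr
      · exact P.trans _ _ _ hsr h'
    · rw [← hs.1.2.2] at hk
      change k ∈ s.head at hk
      simp only [hd, List.mem_singleton] at hk hxs'
      rw [hk, ← hxs']; exact hxA
    · rw [← hs.1.2.2]; exact hd'

/-- The invariant holds because each step skips exactly the rules defeated by `A`. If the head is in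
`A`, this is the second skipping condition. If not, the priority condition supplies a generating
rule ranked higher, whose head literal is already in the stage and defeats the rule. The remainder
`l₂` is generalized because the induction moves rules into it from the end of `l₁`. -/
theorem foldl_step_eq (hP : P.Total) (hA : A ∈ answerSets P.rules)
    (h : P.RespectsPriorities A) (l₁ l₂ : List (Rule α))
    (hl : (P.dualReduct A).Enumerates (l₁ ++ l₂)) :
    l₁.foldl (step A) ∅ = {x | ∃ r ∈ l₁, ¬ Defeats A r ∧ x ∈ r.head} := by
  induction l₁ using List.reverseRecOn generalizing l₂ with
  | nil => simp
  | append_singleton l₁ r' ih =>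
    rw [List.append_assoc] at hl
    rw [List.foldl_append, ih _ hl]
    obtain ⟨r₁, hr₁, hp₁, hrr₁⟩ : ∃ r, P.IsSource A r' r := (hl.1 r').1 (by simp)
    -- The priority condition is applied to the first source of `r'`: the dual reduct compares first
    -- sources, so a rule before a later source need not precede `r'` there.
    obtain ⟨r, ⟨⟨hr, hp, hrr⟩, hfirst⟩, -⟩ := exists_isFirstSource hP hr₁ hp₁
    rw [hrr₁] at hrr hfirst
    have hsub : {x | ∃ r ∈ l₁, ¬ Defeats A r ∧ x ∈ r.head} ⊆ A := by
      rintro x ⟨s', hs', hd, hx⟩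
      obtain ⟨s, hs, hps, rfl⟩ : ∃ s, P.IsSource A s' s := (hl.1 s').1 (by simp [hs'])
      exact mem_of_mem_head hA hs ⟨hps, hd⟩ hx
    have hiff : (Defeats {x | ∃ r ∈ l₁, ¬ Defeats A r ∧ x ∈ r.head} r' ∨
        ((∀ l ∈ r'.head, l ∈ A) ∧ Defeats A r')) ↔ Defeats A r' := by
      constructor
      · rintro (⟨x, hx, hx'⟩ | h')
        · exact ⟨x, hx, hsub hx'⟩
        · exact h'.2
      · intro hd
        by_cases hh : ∀ l ∈ r'.head, l ∈ A
        · exact Or.inr ⟨hh, hd⟩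
        · left
          obtain ⟨c, hc⟩ := P.normal r hr
          have hh' : ∀ l ∈ r.head, l ∉ A := by
            rw [← hrr] at hh
            simpa [Rule.dropPos, hc] using hh
          obtain ⟨s, hsr, hg, x, hxs, hxr⟩ := h r hr hp hh'
          have hs := (P.lt_mem _ _ hsr).1
          obtain ⟨s₀, hs₀, hss₀⟩ := exists_isFirstSource hP hs hg.1
          have hlt : P.lt s₀ r := by
            rcases hss₀ with rfl | h'
            · exact hsr
            · exact P.trans _ _ _ h' hsr
          have hlt' : (P.dualReduct A).lt s.dropPos r' :=
            ⟨s₀, r, hs₀, ⟨⟨hr, hp, hrr⟩, hfirst⟩, hlt⟩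
          refine ⟨x, by rw [← hrr]; exact hxr, s.dropPos, ?_, hg.2, hxs⟩
          -- The enumeration contains `s.dropPos`; since that rule strictly precedes `r'`, it must
          -- already occur in `l₁`.
          have hmem : s.dropPos ∈ l₁ ++ ([r'] ++ l₂) := (hl.1 _).2 ⟨s, hs, hg.1, rfl⟩
          have hpw := List.pairwise_append.1 hl.2
          simp only [List.mem_append, List.mem_singleton] at hmem
          rcases hmem with h' | h' | h'
          · exact h'
          · rw [h'] at hlt'
            exact absurd hlt' ((P.dualReduct A).irrefl _)
          · have := (List.pairwise_append.1 hpw.2.1).2.2 r' (by simp) _ h'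
            exact absurd this ((P.dualReduct A).asymm hlt')
    rw [List.foldl_cons, List.foldl_nil]
    unfold step
    ext x
    by_cases hd : Defeats A r'
    · rw [if_pos (hiff.2 hd)]
      simp only [Set.mem_ofPred_eq, List.mem_append, List.mem_singleton]
      constructor
      · rintro ⟨s, hs, h'⟩
        exact ⟨s, Or.inl hs, h'⟩
      · rintro ⟨s, hs | rfl, h'⟩
        · exact ⟨s, hs, h'⟩
        · exact absurd hd h'.1
    · rw [if_neg (mt hiff.1 hd)]
      simp only [Set.mem_ofPred_eq, List.mem_append, List.mem_singleton, Set.mem_union]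
      constructor
      · rintro (⟨s, hs, h'⟩ | h')
        · exact ⟨s, Or.inl hs, h'⟩
        · exact ⟨r', Or.inr rfl, hd, h'⟩
      · rintro ⟨s, hs | rfl, h'⟩
        · exact Or.inl ⟨s, hs, h'⟩
        · exact Or.inr h'.2

theorem mem_bPreferred_iff (hP : P.Total) :
    A ∈ P.bPreferred ↔ A ∈ answerSets P.rules ∧ P.RespectsPriorities A := by
  have hfull := fullyPrioritized_iff.2 hP
  constructor
  · rintro ⟨hA, ⟨-, -, -, l, hl, h⟩ | ⟨h, -⟩⟩
    · exact ⟨hA, respectsPriorities_of_prefOperator_eq hA hl h⟩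
    · exact absurd hfull h
  · rintro ⟨hA, h⟩
    refine ⟨hA, Or.inl ⟨hfull, hA, mem_answerSets_dualReduct hA, ?_⟩⟩
    obtain ⟨l, hl⟩ := exists_enumerates (dualReduct_total (A := A) hP)
    refine ⟨l, hl, ?_⟩
    have hlast : lastStage A l = A := by
      unfold lastStage
      rw [foldl_step_eq hP hA h l [] (by simpa using hl)]
      ext x
      constructor
      · rintro ⟨r', hr', hd, hx⟩
        obtain ⟨r, hr, hp, rfl⟩ : ∃ r, P.IsSource A r' r := (hl.1 r').1 hr'
        exact mem_of_mem_head hA hr ⟨hp, hd⟩ hx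
      · intro hx
        obtain ⟨r, hr, hg, hxr⟩ := exists_generating hA hx
        exact ⟨r.dropPos, (hl.1 _).2 ⟨r, hr, hg.1, rfl⟩, hg.2, hxr⟩
    unfold prefOperator
    rw [hlast, if_pos (mem_answerSets_iff.1 hA).1]

/-! ### Attainment of the violation degree -/

/-- The order on the rules of `P` in which the rules generating `A` precede the others. -/
def generatingFirst (P : PrioritizedProgram α) (A : Set (Literal α)) : PrioritizedProgram α where
  rules := P.rules
  lt r s := r ∈ P.rules ∧ s ∈ P.rules ∧ Generating A r ∧ ¬ Generating A s
  finite := P.finite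
  normal := P.normal
  lt_mem _ _ h := ⟨h.1, h.2.1⟩
  irrefl _ h := h.2.2.2 h.2.2.1
  trans _ _ _ h h' := absurd h'.2.2.1 h.2.2.2

/-- Place the generating rules first. A rule with true positive body and false head is not
generating, so some literal of `A` defeats it; that literal is the head of a generating rule, which
now has higher priority. -/
theorem exists_total_mem_bPreferred (hA : A ∈ answerSets P.rules) :
    ∃ Q : PrioritizedProgram α, Q.rules = P.rules ∧ Q.Total ∧ A ∈ Q.bPreferred := by
  obtain ⟨Q, hQ, hlt, htot⟩ := (P.generatingFirst A).fullPrioritizations_nonempty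
  refine ⟨Q, hQ, htot, (mem_bPreferred_iff htot).2 ⟨by rw [hQ]; exact hA, ?_⟩⟩
  intro r hr hp hh
  rw [hQ] at hr
  have hr' : r ∈ P.rules := hr
  have hng : ¬ Generating A r := fun hg => by
    obtain ⟨c, hc⟩ := P.normal r hr
    have hcr : c ∈ r.head := by simp [hc]
    exact hh c hcr (mem_of_mem_head hA hr' hg hcr)
  have hd : Defeats A r := by
    by_contra hd
    exact hng ⟨hp, hd⟩
  obtain ⟨x, hxr, hxA⟩ := hd
  obtain ⟨s, hs, hg, hxs⟩ := exists_generating hA hxA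
  exact ⟨s, hlt _ _ ⟨hs, hr', hg, hng⟩, hg, x, hxs, hxr⟩

theorem violationDegree_le {P₁ P₂ : PrioritizedProgram α} (h₁ : P₁ ∈ P.fullPrioritizations)
    (h₂ : P₂.rules = P.rules) (htot : P₂.Total) (hA : A ∈ P₂.bPreferred) :
    P.violationDegree A ≤ distance P₁ P₂ :=
  Nat.sInf_le ⟨P₁, h₁, P₂, h₂, fullyPrioritized_iff.2 htot, hA, rfl⟩

/-- The set of distances is nonempty, so its infimum is attained and is not the default value 0 of
an empty infimum. -/
theorem exists_distance_eq_violationDegree (hA : A ∈ answerSets P.rules) :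
    ∃ P₁ ∈ P.fullPrioritizations, ∃ P₂ : PrioritizedProgram α, P₂.rules = P.rules ∧ P₂.Total ∧
      A ∈ P₂.bPreferred ∧ P.violationDegree A = distance P₁ P₂ := by
  obtain ⟨Q, hQ, htot, hAQ⟩ := exists_total_mem_bPreferred hA
  obtain ⟨P₁, hP₁⟩ := P.fullPrioritizations_nonempty
  obtain ⟨R₁, hR₁, R₂, hR₂, hfull, hAR, heq⟩ := Nat.sInf_mem
    (s := {n | ∃ P₁ ∈ P.fullPrioritizations, ∃ P₂ : PrioritizedProgram α,
      P₂.rules = P.rules ∧ P₂.FullyPrioritized ∧ A ∈ P₂.bPreferred ∧ n = distance P₁ P₂})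
    ⟨_, P₁, hP₁, Q, hQ, fullyPrioritized_iff.2 htot, hAQ, rfl⟩
  exact ⟨R₁, hR₁, R₂, hR₂, fullyPrioritized_iff.1 hfull, hAR, heq⟩

theorem mem_weaklyPreferred_iff :
    A ∈ P.weaklyPreferred ↔ A ∈ answerSets P.rules ∧
      ∀ B ∈ answerSets P.rules, P.violationDegree A ≤ P.violationDegree B := by
  refine and_congr_right fun hA => ⟨fun h B hB => ?_, fun h => le_antisymm ?_ ?_⟩
  · rw [h]
    exact Nat.sInf_le ⟨B, hB, rfl⟩
  · obtain ⟨B, hB, heq⟩ := Nat.sInf_mem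
      (s := {n | ∃ A ∈ answerSets P.rules, n = P.violationDegree A}) ⟨_, A, hA, rfl⟩
    unfold programViolationDegree
    rw [heq]
    exact h B hB
  · exact Nat.sInf_le ⟨A, hA, rfl⟩

/-- A transitive relation that contains the covering pairs of `P.lt` contains `P.lt`. -/
theorem rel_of_lt {R : Rule α → Rule α → Prop}
    (htrans : ∀ r s t, r ∈ P.rules → s ∈ P.rules → t ∈ P.rules → R r s → R s t → R r t)
    (hcov : ∀ r s, P.lt r s → (¬ ∃ t, P.lt r t ∧ P.lt t s) → R r s)
    {r s : Rule α} (h : P.lt r s) : R r s := by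
  -- Strong induction on the number of rules strictly between `r` and `s`: an intermediate `t`
  -- splits the interval into two parts, neither of which contains `t`.
  obtain ⟨n, hn⟩ : ∃ n, {t | P.lt r t ∧ P.lt t s}.ncard = n := ⟨_, rfl⟩
  induction n using Nat.strong_induction_on generalizing r s with
  | _ n ih =>
    by_cases hc : ∃ t, P.lt r t ∧ P.lt t s
    · obtain ⟨t, hrt, hts⟩ := hc
      have hfin : {t | P.lt r t ∧ P.lt t s}.Finite :=
        P.finite.subset fun u hu => (P.lt_mem _ _ hu.1).2
      refine htrans r t s (P.lt_mem _ _ h).1 (P.lt_mem _ _ hrt).2 (P.lt_mem _ _ h).2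
        (ih _ ?_ hrt rfl) (ih _ ?_ hts rfl)
      · rw [← hn]
        refine Set.ncard_lt_ncard ⟨fun u hu => ⟨hu.1, P.trans _ _ _ hu.2 hts⟩, fun h' => ?_⟩ hfin
        exact P.irrefl t (h' (show t ∈ _ from ⟨hrt, hts⟩)).2
      · rw [← hn]
        refine Set.ncard_lt_ncard ⟨fun u hu => ⟨P.trans _ _ _ hrt hu.1, hu.2⟩, fun h' => ?_⟩ hfin
        exact P.irrefl t (h' (show t ∈ _ from ⟨hrt, hts⟩)).1
    · exact hcov r s h hc

end PrioritizedProgram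

/-! ### Closure conditions of the ground meta-interpreter -/

/-- The meta-interpreter together with the representation of `P`. -/
def metaProgram {α C : Type*} (P : PrioritizedProgram α) (litName : Literal α → C)
    (ruleName : Rule α → C) : Program MetaPred MetaVar C :=
  weakMetaInterpreter C ∪ representation P litName ruleName

/-- The substitution with the given values. -/
def assign {C : Type*} (x y z r y' : C) : MetaVar → C
  | .X => x
  | .Y => y
  | .Z => z
  | .R => r
  | .Y1 => y'

/-- Closure under the reduct of the basic meta-interpreter with respect to `I`, for substitutions
with values in `U`. -/
structure BasicClosed {C : Type*} [LinearOrder C] (U : Set C)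
    (I J : Set (Literal (Atom MetaPred C))) : Prop where
  in_AS : ∀ x ∈ U, ∀ r ∈ U, lit .neg_body_false [r] ∉ I → lit .head [x, r] ∈ J →
    lit .pos_body_true [r] ∈ J → lit .in_AS [x] ∈ J
  pos_body_exists : ∀ x ∈ U, ∀ r ∈ U, lit .pbl [x, r] ∈ J → lit .pos_body_exists [r] ∈ J
  pos_body_true : ∀ r ∈ U, lit .pos_body_exists [r] ∉ I → lit .rule [r] ∈ J →
    lit .pos_body_true [r] ∈ J
  inbetween : ∀ x ∈ U, ∀ y ∈ U, ∀ z ∈ U, ∀ r ∈ U, x < z → z < y → lit .pbl [x, r] ∈ J →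
    lit .pbl [y, r] ∈ J → lit .pbl [z, r] ∈ J → lit .pbl_inbetween [x, y, r] ∈ J
  notlast : ∀ x ∈ U, ∀ y ∈ U, ∀ r ∈ U, x < y → lit .pbl [x, r] ∈ J → lit .pbl [y, r] ∈ J →
    lit .pbl_notlast [x, r] ∈ J
  notfirst : ∀ x ∈ U, ∀ y ∈ U, ∀ r ∈ U, y < x → lit .pbl [x, r] ∈ J → lit .pbl [y, r] ∈ J →
    lit .pbl_notfirst [x, r] ∈ J
  upto_first : ∀ x ∈ U, ∀ r ∈ U, lit .pbl_notfirst [x, r] ∉ I → lit .pbl [x, r] ∈ J →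
    lit .in_AS [x] ∈ J → lit .pos_body_true_upto [r, x] ∈ J
  upto_next : ∀ x ∈ U, ∀ y ∈ U, ∀ r ∈ U, y < x → lit .pbl_inbetween [y, x, r] ∉ I →
    lit .pos_body_true_upto [r, y] ∈ J → lit .pbl [x, r] ∈ J → lit .in_AS [x] ∈ J →
    lit .pos_body_true_upto [r, x] ∈ J
  pos_body_true_last : ∀ x ∈ U, ∀ r ∈ U, lit .pbl_notlast [x, r] ∉ I →
    lit .pos_body_true_upto [r, x] ∈ J → lit .pos_body_true [r] ∈ J
  neg_body_false : ∀ x ∈ U, ∀ y ∈ U, lit .nbl [x, y] ∈ J → lit .in_AS [x] ∈ J →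
    lit .neg_body_false [y] ∈ J
  consistent : ∀ x ∈ U, ∀ y ∈ U, ¬ (lit .compl [x, y] ∈ J ∧ lit .in_AS [x] ∈ J ∧
    lit .in_AS [y] ∈ J)

/-- Closure under the reduct of the preference part of the meta-interpreter with respect to `I`,
for substitutions with values in `U`. -/
structure PreferenceClosed {C : Type*} (U : Set C)
    (I J : Set (Literal (Atom MetaPred C))) : Prop where
  pr_total : ∀ x ∈ U, ∀ y ∈ U, x ≠ y → lit .rule [x] ∈ J → lit .rule [y] ∈ J →
    lit .pr [x, y] ∈ J ∨ lit .pr [y, x] ∈ J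
  pr_trans : ∀ x ∈ U, ∀ y ∈ U, ∀ z ∈ U, lit .pr [x, y] ∈ J → lit .pr [y, z] ∈ J →
    lit .pr [x, z] ∈ J
  pr_irrefl : ∀ x ∈ U, lit .pr [x, x] ∉ J
  pr1_total : ∀ x ∈ U, ∀ y ∈ U, x ≠ y → lit .rule [x] ∈ J → lit .rule [y] ∈ J →
    lit .pr1 [x, y] ∈ J ∨ lit .pr1 [y, x] ∈ J
  pr1_trans : ∀ x ∈ U, ∀ y ∈ U, ∀ z ∈ U, lit .pr1 [x, y] ∈ J → lit .pr1 [y, z] ∈ J →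
    lit .pr1 [x, z] ∈ J
  pr1_irrefl : ∀ x ∈ U, lit .pr1 [x, x] ∉ J
  lit_of_not_in_AS : ∀ x ∈ U, ∀ y ∈ U, lit .defeat_local [y] ∉ I → lit .in_AS [x] ∉ I →
    lit .head [x, y] ∈ J → lit .pos_body_true [y] ∈ J → lit .lit [x, y] ∈ J
  lit_of_not_defeat_global : ∀ x ∈ U, ∀ y ∈ U, lit .defeat_local [y] ∉ I →
    lit .defeat_global [y] ∉ I → lit .head [x, y] ∈ J → lit .pos_body_true [y] ∈ J →
    lit .lit [x, y] ∈ J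
  defeat_local : ∀ x ∈ U, ∀ y ∈ U, ∀ y' ∈ U, lit .nbl [x, y] ∈ J → lit .lit [x, y'] ∈ J →
    lit .pr1 [y', y] ∈ J → lit .defeat_local [y] ∈ J
  defeat_global : ∀ x ∈ U, ∀ y ∈ U, lit .nbl [x, y] ∈ J → lit .in_AS [x] ∈ J →
    lit .defeat_global [y] ∈ J
  in_CP : ∀ x ∈ U, ∀ y ∈ U, lit .lit [x, y] ∈ J → lit .in_CP [x] ∈ J
  in_CP_sub : ∀ x ∈ U, lit .in_AS [x] ∉ I → lit .in_CP [x] ∉ J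

/-- `J` contains the facts representing `P`. -/
structure ContainsFacts {α C : Type*} (P : PrioritizedProgram α) (litName : Literal α → C)
    (ruleName : Rule α → C) (J : Set (Literal (Atom MetaPred C))) : Prop where
  rule : ∀ r ∈ P.rules, lit .rule [ruleName r] ∈ J
  head : ∀ r ∈ P.rules, ∀ l ∈ r.head, lit .head [litName l, ruleName r] ∈ J
  pbl : ∀ r ∈ P.rules, ∀ l ∈ r.posBody, lit .pbl [litName l, ruleName r] ∈ J
  nbl : ∀ r ∈ P.rules, ∀ l ∈ r.negBody, lit .nbl [litName l, ruleName r] ∈ J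
  compl : ∀ a, (∃ r ∈ P.rules, Literal.pos a ∈ r.literals) →
    (∃ r ∈ P.rules, Literal.neg a ∈ r.literals) →
    lit .compl [litName (.pos a), litName (.neg a)] ∈ J
  pr : ∀ r s, P.lt r s → (¬ ∃ t, P.lt r t ∧ P.lt t s) → lit .pr [ruleName r, ruleName s] ∈ J

section

variable {α C : Type*} {P : PrioritizedProgram α}
  {litName : Literal α → C} {ruleName : Rule α → C} {I J : Set (Literal (Atom MetaPred C))}

theorem closedUnder_ground_iff [LinearOrder C] [Nonempty C] {S V : Type*} {M : Program S V C}
    {I J : Set (Literal (Atom S C))} :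
    ClosedUnder (reduct M.ground.rules I) J ↔
      ∀ r ∈ M.rules, ∀ σ : V → C, (∀ v, σ v ∈ M.herbrandUniverse) →
        (∀ b ∈ r.builtins, b.Holds σ) →
        (∀ l ∈ r.rule.negBody, l.map (Atom.subst σ) ∉ I) →
        (∀ l ∈ r.rule.posBody, l.map (Atom.subst σ) ∈ J) →
        ∃ l ∈ r.rule.head, l.map (Atom.subst σ) ∈ J := by
  rw [closedUnder_reduct_iff]
  constructor
  · intro h r hr σ hσ hb hn hp
    have := h (r.rule.map (Atom.subst σ)) ⟨r, hr, σ, hσ, hb, rfl⟩ ?_ ?_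
    · simpa [Rule.map] using this
    · rintro ⟨l, hl, hlI⟩
      simp only [Rule.map, List.mem_map] at hl
      obtain ⟨k, hk, rfl⟩ := hl
      exact hn k hk hlI
    · intro l hl
      simp only [Rule.map, List.mem_map] at hl
      obtain ⟨k, hk, rfl⟩ := hl
      exact hp k hk
  · rintro h _ ⟨r, hr, σ, hσ, hb, rfl⟩ hd hp
    obtain ⟨l, hl, hlJ⟩ := h r hr σ hσ hb
      (fun l hl hlI => hd ⟨_, List.mem_map_of_mem hl, hlI⟩)
      (fun l hl => hp _ (List.mem_map_of_mem hl))
    exact ⟨_, List.mem_map_of_mem hl, hlJ⟩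

/-- A ground substitution gives values to all variables, so a rule has instances only if some
constant is available for the variables it does not mention. This matters even for facts. -/
theorem herbrandUniverse_nonempty [Nonempty C] {S V : Type*} (M : Program S V C) :
    ∃ c, c ∈ M.herbrandUniverse := by
  by_cases h : M.constants = ∅
  · exact ⟨_, Or.inr ⟨h, rfl⟩⟩
  · obtain ⟨c, hc⟩ := Set.nonempty_iff_ne_empty.2 h
    exact ⟨c, Or.inl hc⟩

theorem map_subst_lit {V : Type*} (σ : V → C) (p : MetaPred) (ts : List (Term V C)) :
    (lit p ts).map (Atom.subst σ) = lit p (ts.map (Term.subst σ)) := rfl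

theorem mem_metaProgram_rules {r : MetaRule C} :
    r ∈ (metaProgram P litName ruleName).rules ↔
      r ∈ basicRules C ∨ r ∈ preferenceRules C ∨ r ∈ (representation P litName ruleName).rules := by
  change (r ∈ basicRules C ++ preferenceRules C ∨ _) ↔ _
  rw [List.mem_append, or_assoc]

/-- All later arguments about the meta-interpreter go through these closure conditions. `I`
evaluates negation and `J` everything else, so one statement serves both closure of an answer set
and its minimality. -/
theorem metaClosed_iff [LinearOrder C] [Nonempty C] :
    ClosedUnder (reduct (metaProgram P litName ruleName).ground.rules I) J ↔
      BasicClosed (metaProgram P litName ruleName).herbrandUniverse I J ∧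
      PreferenceClosed (metaProgram P litName ruleName).herbrandUniverse I J ∧
      ContainsFacts P litName ruleName J := by
  rw [closedUnder_ground_iff]
  obtain ⟨c, hc⟩ := herbrandUniverse_nonempty (metaProgram P litName ruleName)
  set U := (metaProgram P litName ruleName).herbrandUniverse
  simp only [mem_metaProgram_rules, or_imp, forall_and]
  have hassign : ∀ x ∈ U, ∀ y ∈ U, ∀ z ∈ U, ∀ r ∈ U, ∀ y' ∈ U, ∀ v, assign x y z r y' v ∈ U := by
    intro x hx y hy z hz r hr y' hy' v
    cases v <;> assumption
  refine and_congr ?_ (and_congr ?_ ?_)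
  · simp only [basicRules, List.forall_mem_cons, List.not_mem_nil, false_imp_iff, implies_true,
      and_true, map_subst_lit, List.map_cons, List.map_nil, List.exists_mem_cons_iff,
      exists_false, or_false, Builtin.Holds, Term.subst, true_imp_iff, false_and, imp_false,
      and_imp]
    constructor
    · rintro ⟨h1, h2, h3, h4, h5, h6, h7, h8, h9, h10, h11⟩
      exact {
        in_AS := fun x hx r hr => h1 (assign x c c r c) (hassign _ hx _ hc _ hc _ hr _ hc)
        pos_body_exists := fun x hx r hr =>
          h2 (assign x c c r c) (hassign _ hx _ hc _ hc _ hr _ hc)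
        pos_body_true := fun r hr => h3 (assign c c c r c) (hassign _ hc _ hc _ hc _ hr _ hc)
        inbetween := fun x hx y hy z hz r hr =>
          h4 (assign x y z r c) (hassign _ hx _ hy _ hz _ hr _ hc)
        notlast := fun x hx y hy r hr =>
          h5 (assign x y c r c) (hassign _ hx _ hy _ hc _ hr _ hc)
        notfirst := fun x hx y hy r hr =>
          h6 (assign x y c r c) (hassign _ hx _ hy _ hc _ hr _ hc)
        upto_first := fun x hx r hr => h7 (assign x c c r c) (hassign _ hx _ hc _ hc _ hr _ hc)
        upto_next := fun x hx y hy r hr =>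
          h8 (assign x y c r c) (hassign _ hx _ hy _ hc _ hr _ hc)
        pos_body_true_last := fun x hx r hr =>
          h9 (assign x c c r c) (hassign _ hx _ hc _ hc _ hr _ hc)
        neg_body_false := fun x hx y hy =>
          h10 (assign x y c c c) (hassign _ hx _ hy _ hc _ hc _ hc)
        consistent := fun x hx y hy =>
          h11 (assign x y c c c) (hassign _ hx _ hy _ hc _ hc _ hc) }
    · intro h
      exact ⟨fun σ hσ => h.in_AS _ (hσ _) _ (hσ _), fun σ hσ => h.pos_body_exists _ (hσ _) _ (hσ _),
        fun σ hσ => h.pos_body_true _ (hσ _),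
        fun σ hσ => h.inbetween _ (hσ _) _ (hσ _) _ (hσ _) _ (hσ _),
        fun σ hσ => h.notlast _ (hσ _) _ (hσ _) _ (hσ _),
        fun σ hσ => h.notfirst _ (hσ _) _ (hσ _) _ (hσ _),
        fun σ hσ => h.upto_first _ (hσ _) _ (hσ _),
        fun σ hσ => h.upto_next _ (hσ _) _ (hσ _) _ (hσ _),
        fun σ hσ => h.pos_body_true_last _ (hσ _) _ (hσ _),
        fun σ hσ => h.neg_body_false _ (hσ _) _ (hσ _),
        fun σ hσ => h.consistent _ (hσ _) _ (hσ _)⟩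
  · simp only [preferenceRules, List.forall_mem_cons, List.not_mem_nil, false_imp_iff,
      implies_true, and_true, map_subst_lit, List.map_cons, List.map_nil,
      List.exists_mem_cons_iff, exists_false, or_false, Builtin.Holds, Term.subst, true_imp_iff,
      false_and, imp_false, and_imp]
    constructor
    · rintro ⟨h1, h2, h3, h4, h5, h6, h7, h8, h9, h10, h11, h12⟩
      exact {
        pr_total := fun x hx y hy => h1 (assign x y c c c) (hassign _ hx _ hy _ hc _ hc _ hc)
        pr_trans := fun x hx y hy z hz =>
          h2 (assign x y z c c) (hassign _ hx _ hy _ hz _ hc _ hc)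
        pr_irrefl := fun x hx => h3 (assign x c c c c) (hassign _ hx _ hc _ hc _ hc _ hc)
        pr1_total := fun x hx y hy => h4 (assign x y c c c) (hassign _ hx _ hy _ hc _ hc _ hc)
        pr1_trans := fun x hx y hy z hz =>
          h5 (assign x y z c c) (hassign _ hx _ hy _ hz _ hc _ hc)
        pr1_irrefl := fun x hx => h6 (assign x c c c c) (hassign _ hx _ hc _ hc _ hc _ hc)
        lit_of_not_in_AS := fun x hx y hy =>
          h7 (assign x y c c c) (hassign _ hx _ hy _ hc _ hc _ hc)
        lit_of_not_defeat_global := fun x hx y hy =>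
          h8 (assign x y c c c) (hassign _ hx _ hy _ hc _ hc _ hc)
        defeat_local := fun x hx y hy z hz =>
          h9 (assign x y c c z) (hassign _ hx _ hy _ hc _ hc _ hz)
        defeat_global := fun x hx y hy =>
          h10 (assign x y c c c) (hassign _ hx _ hy _ hc _ hc _ hc)
        in_CP := fun x hx y hy => h11 (assign x y c c c) (hassign _ hx _ hy _ hc _ hc _ hc)
        in_CP_sub := fun x hx => h12 (assign x c c c c) (hassign _ hx _ hc _ hc _ hc _ hc) }
    · intro h
      exact ⟨fun σ hσ => h.pr_total _ (hσ _) _ (hσ _),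
        fun σ hσ => h.pr_trans _ (hσ _) _ (hσ _) _ (hσ _),
        fun σ hσ => h.pr_irrefl _ (hσ _),
        fun σ hσ => h.pr1_total _ (hσ _) _ (hσ _),
        fun σ hσ => h.pr1_trans _ (hσ _) _ (hσ _) _ (hσ _),
        fun σ hσ => h.pr1_irrefl _ (hσ _),
        fun σ hσ => h.lit_of_not_in_AS _ (hσ _) _ (hσ _),
        fun σ hσ => h.lit_of_not_defeat_global _ (hσ _) _ (hσ _),
        fun σ hσ => h.defeat_local _ (hσ _) _ (hσ _) _ (hσ _),
        fun σ hσ => h.defeat_global _ (hσ _) _ (hσ _),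
        fun σ hσ => h.in_CP _ (hσ _) _ (hσ _),
        fun σ hσ => h.in_CP_sub _ (hσ _)⟩
  · have hfact : ∀ p (cs : List C), (∀ σ : MetaVar → C, (∀ v, σ v ∈ U) →
        (∀ b ∈ (fact p cs).builtins, b.Holds σ) →
        (∀ l ∈ (fact p cs).rule.negBody, l.map (Atom.subst σ) ∉ I) →
        (∀ l ∈ (fact p cs).rule.posBody, l.map (Atom.subst σ) ∈ J) →
        ∃ l ∈ (fact p cs).rule.head, l.map (Atom.subst σ) ∈ J) ↔ lit p cs ∈ J := by
      intro p cs
      have hs : ∀ σ : MetaVar → C,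
          (lit p (cs.map Term.const)).map (Atom.subst σ) = lit p cs := by
        intro σ
        rw [map_subst_lit, List.map_map]
        congr 1
        exact List.map_id cs
      constructor
      · intro h
        obtain ⟨l, hl, hlJ⟩ := h (fun _ => c) (fun _ => hc) (by simp [fact]) (by simp [fact])
          (by simp [fact])
        simp only [fact, List.mem_singleton] at hl
        rwa [hl, hs] at hlJ
      · intro h σ _ _ _ _
        exact ⟨_, List.mem_singleton.2 rfl, by rw [hs]; exact h⟩
    constructor
    · intro h
      have h' : ∀ p cs, fact p cs ∈ (representation P litName ruleName).rules → lit p cs ∈ J :=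
        fun p cs hm => (hfact p cs).1 (h _ hm)
      exact {
        rule := fun r hr => h' _ _ (.inl (.inl (.inl (.inl (.inl ⟨r, hr, rfl⟩)))))
        head := fun r hr l hl => h' _ _ (.inl (.inl (.inl (.inl (.inr ⟨r, hr, l, hl, rfl⟩)))))
        pbl := fun r hr l hl => h' _ _ (.inl (.inl (.inl (.inr ⟨r, hr, l, hl, rfl⟩))))
        nbl := fun r hr l hl => h' _ _ (.inl (.inl (.inr ⟨r, hr, l, hl, rfl⟩)))
        compl := fun a h1 h2 => h' _ _ (.inl (.inr ⟨a, h1, h2, rfl⟩))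
        pr := fun r s h1 h2 => h' _ _ (.inr ⟨r, s, h1, h2, rfl⟩) }
    · rintro h f (((((⟨r, hr, rfl⟩ | ⟨r, hr, l, hl, rfl⟩) | ⟨r, hr, l, hl, rfl⟩) |
        ⟨r, hr, l, hl, rfl⟩) | ⟨a, h1, h2, rfl⟩) | ⟨r, s, h1, h2, rfl⟩)
      · exact (hfact _ _).2 (h.rule r hr)
      · exact (hfact _ _).2 (h.head r hr l hl)
      · exact (hfact _ _).2 (h.pbl r hr l hl)
      · exact (hfact _ _).2 (h.nbl r hr l hl)
      · exact (hfact _ _).2 (h.compl a h1 h2)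
      · exact (hfact _ _).2 (h.pr r s h1 h2)

theorem mem_herbrandUniverse_of_fact [Nonempty C] {p : MetaPred} {cs : List C} {c : C}
    (hf : fact p cs ∈ (representation P litName ruleName).rules) (hc : c ∈ cs) :
    c ∈ (metaProgram P litName ruleName).herbrandUniverse := by
  refine Or.inl (Or.inl ⟨_, Or.inr hf, ?_⟩)
  simp [Program.ruleTerms, fact, Rule.literals, lit, Literal.atom, hc]

theorem ruleName_mem_herbrandUniverse [Nonempty C] {r : Rule α} (hr : r ∈ P.rules) :
    ruleName r ∈ (metaProgram P litName ruleName).herbrandUniverse :=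
  mem_herbrandUniverse_of_fact (p := .rule) (cs := [ruleName r])
    (.inl (.inl (.inl (.inl (.inl ⟨r, hr, rfl⟩))))) (by simp)

theorem litName_mem_herbrandUniverse [Nonempty C] {r : Rule α} (hr : r ∈ P.rules) {l : Literal α}
    (hl : l ∈ r.literals) :
    litName l ∈ (metaProgram P litName ruleName).herbrandUniverse := by
  simp only [Rule.literals, List.mem_append] at hl
  rcases hl with (hl | hl) | hl
  · exact mem_herbrandUniverse_of_fact (p := .head) (cs := [litName l, ruleName r])
      (.inl (.inl (.inl (.inl (.inr ⟨r, hr, l, hl, rfl⟩))))) (by simp)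
  · exact mem_herbrandUniverse_of_fact (p := .pbl) (cs := [litName l, ruleName r])
      (.inl (.inl (.inl (.inr ⟨r, hr, l, hl, rfl⟩)))) (by simp)
  · exact mem_herbrandUniverse_of_fact (p := .nbl) (cs := [litName l, ruleName r])
      (.inl (.inl (.inr ⟨r, hr, l, hl, rfl⟩))) (by simp)

end

/-! ### Explicit interpretations bounding the answer sets -/

section

variable {α C : Type*}

/-- The interpretation of the predicates of the meta-interpreter that is determined by a set
`A`, relative to which negation is evaluated, a set `B`, relative to which positive bodies
are evaluated, and relations `R₁` and `R₂` on the rules. -/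
def Interp [LinearOrder C] (P : PrioritizedProgram α) (litName : Literal α → C)
    (ruleName : Rule α → C) (A B : Set (Literal α)) (R₁ R₂ : Rule α → Rule α → Prop) :
    MetaPred → List C → Prop
  | .rule, [ρ] => ∃ r ∈ P.rules, ρ = ruleName r
  | .head, [x, ρ] => ∃ r ∈ P.rules, ∃ l ∈ r.head, x = litName l ∧ ρ = ruleName r
  | .pbl, [x, ρ] => ∃ r ∈ P.rules, ∃ l ∈ r.posBody, x = litName l ∧ ρ = ruleName r
  | .nbl, [x, ρ] => ∃ r ∈ P.rules, ∃ l ∈ r.negBody, x = litName l ∧ ρ = ruleName r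
  | .compl, [x, y] => ∃ a, (∃ r ∈ P.rules, Literal.pos a ∈ r.literals) ∧
      (∃ r ∈ P.rules, Literal.neg a ∈ r.literals) ∧ x = litName (.pos a) ∧ y = litName (.neg a)
  | .in_AS, [x] => ∃ l ∈ B, x = litName l
  | .pos_body_exists, [ρ] => ∃ r ∈ P.rules, ∃ l, l ∈ r.posBody ∧ ρ = ruleName r
  | .pos_body_true, [ρ] => ∃ r ∈ P.rules, ρ = ruleName r ∧ ∀ l ∈ r.posBody, l ∈ B
  | .pbl_inbetween, [x, y, ρ] => ∃ r ∈ P.rules, ρ = ruleName r ∧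
      (∃ l ∈ r.posBody, x = litName l) ∧ (∃ l ∈ r.posBody, y = litName l) ∧
      ∃ l ∈ r.posBody, x < litName l ∧ litName l < y
  | .pbl_notlast, [x, ρ] => ∃ r ∈ P.rules, ρ = ruleName r ∧
      (∃ l ∈ r.posBody, x = litName l) ∧ ∃ l ∈ r.posBody, x < litName l
  | .pbl_notfirst, [x, ρ] => ∃ r ∈ P.rules, ρ = ruleName r ∧
      (∃ l ∈ r.posBody, x = litName l) ∧ ∃ l ∈ r.posBody, litName l < x
  | .pos_body_true_upto, [ρ, x] => ∃ r ∈ P.rules, ρ = ruleName r ∧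
      ∃ l ∈ r.posBody, x = litName l ∧ ∀ k ∈ r.posBody, litName k ≤ litName l → k ∈ B
  | .neg_body_false, [ρ] => ∃ r ∈ P.rules, ρ = ruleName r ∧ Defeats A r
  | .pr, [x, y] => ∃ r ∈ P.rules, ∃ s ∈ P.rules, R₁ r s ∧ x = ruleName r ∧ y = ruleName s
  | .pr1, [x, y] => ∃ r ∈ P.rules, ∃ s ∈ P.rules, R₂ r s ∧ x = ruleName r ∧ y = ruleName s
  | .lit, [x, ρ] => ∃ r ∈ P.rules, ∃ l ∈ r.head, x = litName l ∧ ρ = ruleName r ∧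
      (∀ k ∈ r.posBody, k ∈ B) ∧ ¬ Defeats A r
  | .defeat_local, [ρ] => ∃ r ∈ P.rules, ρ = ruleName r ∧ ∃ s ∈ P.rules, R₂ s r ∧
      ((∀ k ∈ s.posBody, k ∈ B) ∧ ¬ Defeats A s) ∧ ∃ l ∈ s.head, l ∈ r.negBody
  | .defeat_global, [ρ] => ∃ r ∈ P.rules, ρ = ruleName r ∧ Defeats A r
  | .in_CP, [x] => ∃ l ∈ A, x = litName l
  | _, _ => False

/-- The set of literals that are true in the interpretation `Interp`. -/
def model [LinearOrder C] (P : PrioritizedProgram α) (litName : Literal α → C)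
    (ruleName : Rule α → C) (A B : Set (Literal α)) (R₁ R₂ : Rule α → Rule α → Prop) :
    Set (Literal (Atom MetaPred C)) :=
  {l | ∃ p ts, l = lit p ts ∧ Interp P litName ruleName A B R₁ R₂ p ts}

variable [LinearOrder C] {P : PrioritizedProgram α} {litName : Literal α → C}
  {ruleName : Rule α → C} {A B : Set (Literal α)} {R₁ R₂ : Rule α → Rule α → Prop}
  {I J : Set (Literal (Atom MetaPred C))}

theorem mem_model {p : MetaPred} {ts : List C} :
    lit p ts ∈ model P litName ruleName A B R₁ R₂ ↔
      Interp P litName ruleName A B R₁ R₂ p ts := by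
  constructor
  · rintro ⟨q, us, h, h'⟩
    simp only [lit, Literal.pos.injEq, Atom.mk.injEq] at h
    obtain ⟨rfl, rfl⟩ := h
    exact h'
  · intro h
    exact ⟨p, ts, rfl, h⟩

theorem consistent_model : Consistent (model P litName ruleName A B R₁ R₂) := by
  rintro _ ⟨p, ts, rfl, -⟩ ⟨q, us, h, -⟩
  simp [lit, Literal.compl] at h

/-- The predicate walks through the positive body in the built-in order of names, so the proof is an
induction on the number of body literals with smaller names. Bounding `I` by the explicit
interpretation ensures that the negated atoms of the two recursive clauses are absent from `I` where
needed. -/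
theorem pos_body_true_upto_mem [Nonempty C] (hrule : Set.InjOn ruleName P.rules)
    (hI : I ⊆ model P litName ruleName A B R₁ R₂)
    (hJ : BasicClosed (metaProgram P litName ruleName).herbrandUniverse I J)
    (hF : ContainsFacts P litName ruleName J) {r : Rule α} (hr : r ∈ P.rules) {l : Literal α}
    (hl : l ∈ r.posBody)
    (h : ∀ k ∈ r.posBody, litName k ≤ litName l → lit .in_AS [litName k] ∈ J) :
    lit .pos_body_true_upto [ruleName r, litName l] ∈ J := by
  have hU : ∀ k ∈ r.posBody, litName k ∈ (metaProgram P litName ruleName).herbrandUniverse :=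
    fun k hk => litName_mem_herbrandUniverse hr (by simp [Rule.literals, hk])
  have hrU := ruleName_mem_herbrandUniverse (litName := litName) (ruleName := ruleName) hr
  obtain ⟨n, hn⟩ : ∃ n, ((r.posBody.map litName).toFinset.filter (· < litName l)).card = n :=
    ⟨_, rfl⟩
  induction n using Nat.strong_induction_on generalizing l with
  | _ n ih =>
    rcases ((r.posBody.map litName).toFinset.filter (· < litName l)).eq_empty_or_nonempty with
      he | hne
    · refine hJ.upto_first _ (hU l hl) _ hrU (fun hnf => ?_) (hF.pbl r hr l hl) (h l hl le_rfl)
      obtain ⟨r', hr', heq, -, k, hk, hlt⟩ := mem_model.1 (hI hnf)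
      obtain rfl := hrule hr hr' heq
      have : litName k ∈ (r.posBody.map litName).toFinset.filter (· < litName l) := by
        simp only [Finset.mem_filter, List.mem_toFinset, List.mem_map]
        exact ⟨⟨k, hk, rfl⟩, hlt⟩
      rw [he] at this
      exact absurd this (Finset.notMem_empty _)
    -- The largest smaller name is the immediate predecessor, so nothing lies in between.
    · obtain ⟨y, hy, hmax⟩ := Finset.exists_max_image _ id hne
      simp only [Finset.mem_filter, List.mem_toFinset, List.mem_map] at hy
      obtain ⟨⟨k, hk, rfl⟩, hkl⟩ := hy
      refine hJ.upto_next _ (hU l hl) _ (hU k hk) _ hrU hkl (fun hnb => ?_) (ih _ ?_ hk ?_ rfl)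
        (hF.pbl r hr l hl) (h l hl le_rfl)
      · obtain ⟨r', hr', heq, -, -, m, hm, hkm, hml⟩ := mem_model.1 (hI hnb)
        obtain rfl := hrule hr hr' heq
        have := hmax (litName m) (by
          simp only [Finset.mem_filter, List.mem_toFinset, List.mem_map]
          exact ⟨⟨m, hm, rfl⟩, hml⟩)
        exact absurd hkm (not_lt.2 this)
      · rw [← hn]
        refine Finset.card_lt_card ((Finset.ssubset_iff_of_subset ?_).2 ⟨litName k, ?_, ?_⟩)
        · intro z hz
          simp only [Finset.mem_filter] at hz ⊢
          exact ⟨hz.1, hz.2.trans hkl⟩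
        · simp only [Finset.mem_filter, List.mem_toFinset, List.mem_map]
          exact ⟨⟨k, hk, rfl⟩, hkl⟩
        · simp
      · intro m hm hmk
        exact h m hm (hmk.trans hkl.le)

/-- An empty positive body is handled by the clause for rules without one; otherwise the walk is
completed at the body literal with the largest name. -/
theorem pos_body_true_mem [Nonempty C] (hrule : Set.InjOn ruleName P.rules)
    (hI : I ⊆ model P litName ruleName A B R₁ R₂)
    (hJ : BasicClosed (metaProgram P litName ruleName).herbrandUniverse I J)
    (hF : ContainsFacts P litName ruleName J) {r : Rule α} (hr : r ∈ P.rules)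
    (h : ∀ k ∈ r.posBody, lit .in_AS [litName k] ∈ J) :
    lit .pos_body_true [ruleName r] ∈ J := by
  have hrU := ruleName_mem_herbrandUniverse (litName := litName) (ruleName := ruleName) hr
  rcases (r.posBody.map litName).toFinset.eq_empty_or_nonempty with he | hne
  · refine hJ.pos_body_true _ hrU (fun hex => ?_) (hF.rule r hr)
    obtain ⟨r', hr', k, hk, heq⟩ := mem_model.1 (hI hex)
    obtain rfl := hrule hr hr' heq
    have : litName k ∈ (r.posBody.map litName).toFinset := by
      simp only [List.mem_toFinset, List.mem_map]
      exact ⟨k, hk, rfl⟩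
    rw [he] at this
    exact absurd this (Finset.notMem_empty _)
  · obtain ⟨y, hy, hmax⟩ := Finset.exists_max_image _ id hne
    simp only [List.mem_toFinset, List.mem_map] at hy
    obtain ⟨l, hl, rfl⟩ := hy
    refine hJ.pos_body_true_last (litName l)
      (litName_mem_herbrandUniverse hr (by simp [Rule.literals, hl])) _ hrU (fun hnl => ?_)
      (pos_body_true_upto_mem hrule hI hJ hF hr hl fun k hk _ => h k hk)
    obtain ⟨r', hr', heq, -, m, hm, hlm⟩ := mem_model.1 (hI hnl)
    obtain rfl := hrule hr hr' heq
    have := hmax (litName m) (by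
      simp only [List.mem_toFinset, List.mem_map]
      exact ⟨m, hm, rfl⟩)
    exact absurd hlm (not_lt.2 this)

variable [Nonempty C]

/-- An answer set `I` of the meta-interpreter is contained in the interpretation that evaluates
positive bodies relative to any set `B` closed under the rules not defeated by the projection
of `I`. -/
theorem subset_model (hlit : Function.Injective litName) (hrule : Set.InjOn ruleName P.rules)
    (hI : I ∈ answerSets (metaProgram P litName ruleName).ground.rules)
    (hB : ∀ r ∈ P.rules, ¬ Defeats (projection litName I) r → (∀ l ∈ r.posBody, l ∈ B) →
      ∀ l ∈ r.head, l ∈ projection litName I → l ∈ B) :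
    I ⊆ model P litName ruleName (projection litName I) B
      (fun r s => lit .pr [ruleName r, ruleName s] ∈ I)
      (fun r s => lit .pr1 [ruleName r, ruleName s] ∈ I) := by
  obtain ⟨-, hclosed, hmin⟩ := mem_answerSets_iff.1 hI
  obtain ⟨hb, hp, hf⟩ := metaClosed_iff.1 hclosed
  have hneg : ∀ r ∈ P.rules, ∀ k ∈ r.negBody,
      litName k ∈ (metaProgram P litName ruleName).herbrandUniverse :=
    fun r hr k hk => litName_mem_herbrandUniverse hr (by simp [Rule.literals, hk])
  have hCP : ∀ x ∈ (metaProgram P litName ruleName).herbrandUniverse,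
      lit .in_CP [x] ∈ I → lit .in_AS [x] ∈ I :=
    fun x hx h => by_contra fun h' => hp.in_CP_sub x hx h' h
  -- By minimality it suffices that the part of `I` inside the interpretation is still closed under
  -- the reduct by `I`. Membership in `I` comes from closure of `I`, so only membership in the
  -- interpretation is at issue.
  refine (hmin (I ∩ _) Set.inter_subset_left (metaClosed_iff.2 ⟨?_, ?_, ?_⟩)).trans
    Set.inter_subset_right
  · exact {
      in_AS := by
        rintro x hx ρ hρ hn ⟨h1, h1'⟩ ⟨h2, h2'⟩
        obtain ⟨r, hr, l, hl, rfl, rfl⟩ := mem_model.1 h1'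
        obtain ⟨r', hr', heq, hrB⟩ := mem_model.1 h2'
        obtain rfl := hrule hr hr' heq
        have h3 := hb.in_AS _ hx _ hρ hn h1 h2
        refine ⟨h3, mem_model.2 ⟨l, hB r hr ?_ hrB l hl h3, rfl⟩⟩
        rintro ⟨k, hk, hkA⟩
        exact hn (hb.neg_body_false _ (hneg r hr k hk) _ hρ (hf.nbl r hr k hk) hkA)
      pos_body_exists := by
        rintro x hx ρ hρ ⟨h1, h1'⟩
        obtain ⟨r, hr, l, hl, rfl, rfl⟩ := mem_model.1 h1'
        exact ⟨hb.pos_body_exists _ hx _ hρ h1, mem_model.2 ⟨r, hr, l, hl, rfl⟩⟩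
      pos_body_true := by
        rintro ρ hρ hn ⟨h1, h1'⟩
        obtain ⟨r, hr, rfl⟩ := mem_model.1 h1'
        refine ⟨hb.pos_body_true _ hρ hn h1, mem_model.2 ⟨r, hr, rfl, fun l hl => ?_⟩⟩
        exact absurd (hb.pos_body_exists _
          (litName_mem_herbrandUniverse hr (by simp [Rule.literals, hl])) _ hρ
          (hf.pbl r hr l hl)) hn
      inbetween := by
        rintro x hx y hy z hz ρ hρ hxz hzy ⟨h1, h1'⟩ ⟨h2, h2'⟩ ⟨h3, h3'⟩
        obtain ⟨r, hr, l, hl, rfl, rfl⟩ := mem_model.1 h1'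
        obtain ⟨r', hr', k, hk, rfl, heq⟩ := mem_model.1 h2'
        obtain rfl := hrule hr hr' heq
        obtain ⟨r', hr', m, hm, rfl, heq⟩ := mem_model.1 h3'
        obtain rfl := hrule hr hr' heq
        exact ⟨hb.inbetween _ hx _ hy _ hz _ hρ hxz hzy h1 h2 h3,
          mem_model.2 ⟨r, hr, rfl, ⟨l, hl, rfl⟩, ⟨k, hk, rfl⟩, m, hm, hxz, hzy⟩⟩
      notlast := by
        rintro x hx y hy ρ hρ hxy ⟨h1, h1'⟩ ⟨h2, h2'⟩
        obtain ⟨r, hr, l, hl, rfl, rfl⟩ := mem_model.1 h1'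
        obtain ⟨r', hr', k, hk, rfl, heq⟩ := mem_model.1 h2'
        obtain rfl := hrule hr hr' heq
        exact ⟨hb.notlast _ hx _ hy _ hρ hxy h1 h2,
          mem_model.2 ⟨r, hr, rfl, ⟨l, hl, rfl⟩, k, hk, hxy⟩⟩
      notfirst := by
        rintro x hx y hy ρ hρ hxy ⟨h1, h1'⟩ ⟨h2, h2'⟩
        obtain ⟨r, hr, l, hl, rfl, rfl⟩ := mem_model.1 h1'
        obtain ⟨r', hr', k, hk, rfl, heq⟩ := mem_model.1 h2'
        obtain rfl := hrule hr hr' heq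
        exact ⟨hb.notfirst _ hx _ hy _ hρ hxy h1 h2,
          mem_model.2 ⟨r, hr, rfl, ⟨l, hl, rfl⟩, k, hk, hxy⟩⟩
      upto_first := by
        rintro x hx ρ hρ hn ⟨h1, h1'⟩ ⟨h2, h2'⟩
        obtain ⟨r, hr, l, hl, rfl, rfl⟩ := mem_model.1 h1'
        obtain ⟨l', hl', heq⟩ := mem_model.1 h2'
        obtain rfl := hlit heq
        refine ⟨hb.upto_first _ hx _ hρ hn h1 h2, mem_model.2 ⟨r, hr, rfl, l, hl, rfl, ?_⟩⟩
        intro k hk hkl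
        rcases hkl.lt_or_eq with h | h
        · exact absurd (hb.notfirst _ hx _
            (litName_mem_herbrandUniverse hr (by simp [Rule.literals, hk])) _ hρ h h1
            (hf.pbl r hr k hk)) hn
        · rw [hlit h]
          exact hl'
      upto_next := by
        rintro x hx y hy ρ hρ hyx hn ⟨h1, h1'⟩ ⟨h2, h2'⟩ ⟨h3, h3'⟩
        obtain ⟨r, hr, l, hl, rfl, rfl⟩ := mem_model.1 h2'
        obtain ⟨r', hr', heq, m, hm, rfl, hmB⟩ := mem_model.1 h1'
        obtain rfl := hrule hr hr' heq
        obtain ⟨l', hl', heq⟩ := mem_model.1 h3'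
        obtain rfl := hlit heq
        refine ⟨hb.upto_next _ hx _ hy _ hρ hyx hn h1 h2 h3,
          mem_model.2 ⟨r, hr, rfl, l, hl, rfl, ?_⟩⟩
        intro k hk hkl
        rcases hkl.lt_or_eq with h | h
        · rcases le_or_gt (litName k) (litName m) with h' | h'
          · exact hmB k hk h'
          · exact absurd (hb.inbetween _ hy _ hx _
              (litName_mem_herbrandUniverse hr (by simp [Rule.literals, hk])) _ hρ h' h
              (hf.pbl r hr m hm) h2 (hf.pbl r hr k hk)) hn
        · rw [hlit h]
          exact hl'
      pos_body_true_last := by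
        rintro x hx ρ hρ hn ⟨h1, h1'⟩
        obtain ⟨r, hr, rfl, l, hl, rfl, hlB⟩ := mem_model.1 h1'
        refine ⟨hb.pos_body_true_last _ hx _ hρ hn h1, mem_model.2 ⟨r, hr, rfl, ?_⟩⟩
        intro k hk
        refine hlB k hk (not_lt.1 fun h => hn ?_)
        exact hb.notlast _ hx _ (litName_mem_herbrandUniverse hr (by simp [Rule.literals, hk]))
          _ hρ h (hf.pbl r hr l hl) (hf.pbl r hr k hk)
      neg_body_false := by
        rintro x hx ρ hρ ⟨h1, h1'⟩ ⟨h2, -⟩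
        obtain ⟨r, hr, l, hl, rfl, rfl⟩ := mem_model.1 h1'
        exact ⟨hb.neg_body_false _ hx _ hρ h1 h2, mem_model.2 ⟨r, hr, rfl, l, hl, h2⟩⟩
      consistent := by
        rintro x hx y hy ⟨h1, h2, h3⟩
        exact hb.consistent x hx y hy ⟨h1.1, h2.1, h3.1⟩ }
  · exact {
      pr_total := by
        rintro x hx y hy hne ⟨h1, h1'⟩ ⟨h2, h2'⟩
        obtain ⟨r, hr, rfl⟩ := mem_model.1 h1'
        obtain ⟨s, hs, rfl⟩ := mem_model.1 h2'
        rcases hp.pr_total _ hx _ hy hne h1 h2 with h | h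
        · exact Or.inl ⟨h, mem_model.2 ⟨r, hr, s, hs, h, rfl, rfl⟩⟩
        · exact Or.inr ⟨h, mem_model.2 ⟨s, hs, r, hr, h, rfl, rfl⟩⟩
      pr_trans := by
        rintro x hx y hy z hz ⟨h1, h1'⟩ ⟨h2, h2'⟩
        have h := hp.pr_trans _ hx _ hy _ hz h1 h2
        obtain ⟨r, hr, s, hs, -, rfl, rfl⟩ := mem_model.1 h1'
        obtain ⟨s', hs', t, ht, -, heq, rfl⟩ := mem_model.1 h2'
        exact ⟨h, mem_model.2 ⟨r, hr, t, ht, h, rfl, rfl⟩⟩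
      pr_irrefl := fun x hx h => hp.pr_irrefl x hx h.1
      pr1_total := by
        rintro x hx y hy hne ⟨h1, h1'⟩ ⟨h2, h2'⟩
        obtain ⟨r, hr, rfl⟩ := mem_model.1 h1'
        obtain ⟨s, hs, rfl⟩ := mem_model.1 h2'
        rcases hp.pr1_total _ hx _ hy hne h1 h2 with h | h
        · exact Or.inl ⟨h, mem_model.2 ⟨r, hr, s, hs, h, rfl, rfl⟩⟩
        · exact Or.inr ⟨h, mem_model.2 ⟨s, hs, r, hr, h, rfl, rfl⟩⟩
      pr1_trans := by
        rintro x hx y hy z hz ⟨h1, h1'⟩ ⟨h2, h2'⟩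
        have h := hp.pr1_trans _ hx _ hy _ hz h1 h2
        obtain ⟨r, hr, s, hs, -, rfl, rfl⟩ := mem_model.1 h1'
        obtain ⟨s', hs', t, ht, -, heq, rfl⟩ := mem_model.1 h2'
        exact ⟨h, mem_model.2 ⟨r, hr, t, ht, h, rfl, rfl⟩⟩
      pr1_irrefl := fun x hx h => hp.pr1_irrefl x hx h.1
      lit_of_not_in_AS := by
        rintro x hx ρ hρ hn hn' ⟨h1, -⟩ ⟨h2, -⟩
        have h := hp.lit_of_not_in_AS _ hx _ hρ hn hn' h1 h2
        -- The first clause for `lit` never fires in an answer set: it would put a literal outside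
        -- `in_AS` into `in_CP`, against the constraint. So `lit` comes only from rules not defeated
        -- by `A`.
        exact absurd (hCP _ hx (hp.in_CP _ hx _ hρ h)) hn'
      lit_of_not_defeat_global := by
        rintro x hx ρ hρ hn hn' ⟨h1, h1'⟩ ⟨h2, h2'⟩
        have h := hp.lit_of_not_defeat_global _ hx _ hρ hn hn' h1 h2
        obtain ⟨r, hr, l, hl, rfl, rfl⟩ := mem_model.1 h1'
        obtain ⟨r', hr', heq, hrB⟩ := mem_model.1 h2'
        obtain rfl := hrule hr hr' heq
        refine ⟨h, mem_model.2 ⟨r, hr, l, hl, rfl, rfl, hrB, ?_⟩⟩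
        rintro ⟨k, hk, hkA⟩
        exact hn' (hp.defeat_global _ (hneg r hr k hk) _ hρ (hf.nbl r hr k hk) hkA)
      defeat_local := by
        rintro x hx ρ hρ ρ' hρ' ⟨h1, h1'⟩ ⟨h2, h2'⟩ ⟨h3, h3'⟩
        have h := hp.defeat_local _ hx _ hρ _ hρ' h1 h2 h3
        obtain ⟨r, hr, l, hl, rfl, rfl⟩ := mem_model.1 h1'
        obtain ⟨s, hs, l', hl', heq, rfl, hg⟩ := mem_model.1 h2'
        obtain rfl := hlit heq
        exact ⟨h, mem_model.2 ⟨r, hr, rfl, s, hs, h3, hg, l, hl', hl⟩⟩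
      defeat_global := by
        rintro x hx ρ hρ ⟨h1, h1'⟩ ⟨h2, -⟩
        obtain ⟨r, hr, l, hl, rfl, rfl⟩ := mem_model.1 h1'
        exact ⟨hp.defeat_global _ hx _ hρ h1 h2, mem_model.2 ⟨r, hr, rfl, l, hl, h2⟩⟩
      in_CP := by
        rintro x hx ρ hρ ⟨h1, h1'⟩
        have h := hp.in_CP _ hx _ hρ h1
        obtain ⟨r, hr, l, hl, rfl, -⟩ := mem_model.1 h1'
        exact ⟨h, mem_model.2 ⟨l, hCP _ hx h, rfl⟩⟩
      in_CP_sub := by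
        rintro x hx hn ⟨h, -⟩
        exact hp.in_CP_sub x hx (fun h' => hn h') h }
  · exact {
      rule := fun r hr => ⟨hf.rule r hr, mem_model.2 ⟨r, hr, rfl⟩⟩
      head := fun r hr l hl => ⟨hf.head r hr l hl, mem_model.2 ⟨r, hr, l, hl, rfl, rfl⟩⟩
      pbl := fun r hr l hl => ⟨hf.pbl r hr l hl, mem_model.2 ⟨r, hr, l, hl, rfl, rfl⟩⟩
      nbl := fun r hr l hl => ⟨hf.nbl r hr l hl, mem_model.2 ⟨r, hr, l, hl, rfl, rfl⟩⟩
      compl := fun a h1 h2 => ⟨hf.compl a h1 h2, mem_model.2 ⟨a, h1, h2, rfl, rfl⟩⟩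
      pr := fun r s h1 h2 => ⟨hf.pr r s h1 h2, mem_model.2
        ⟨r, (P.lt_mem _ _ h1).1, s, (P.lt_mem _ _ h1).2, hf.pr r s h1 h2, rfl, rfl⟩⟩ }

/-! ### From answer sets of the meta-interpreter to answer sets and orders -/

/-- The projection of an answer set of the meta-interpreter is an answer set. -/
theorem projection_mem_answerSets (hlit : Function.Injective litName)
    (hrule : Set.InjOn ruleName P.rules)
    (hI : I ∈ answerSets (metaProgram P litName ruleName).ground.rules) :
    projection litName I ∈ answerSets P.rules := by
  have hmod := subset_model hlit hrule hI fun r hr hd hp l hl h => h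
  obtain ⟨-, hclosed, -⟩ := mem_answerSets_iff.1 hI
  obtain ⟨hb, hp, hf⟩ := metaClosed_iff.1 hclosed
  refine mem_answerSets_iff.2 ⟨?_, ?_, ?_⟩
  -- Facts `compl` exist only for atoms both of whose literals occur in `P`. Restricting `B` to head
  -- literals of `P` shows that all literals of the projection occur there.
  · have hmod' := subset_model (B := {l | l ∈ projection litName I ∧ ∃ r ∈ P.rules, l ∈ r.head})
      hlit hrule hI fun r hr hd hp l hl h => ⟨h, r, hr, hl⟩
    have hocc : ∀ l ∈ projection litName I, ∃ r ∈ P.rules, l ∈ r.literals := by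
      intro l hl
      obtain ⟨k, ⟨-, r, hr, hk⟩, heq⟩ := mem_model.1 (hmod' hl)
      obtain rfl := hlit heq
      exact ⟨r, hr, by simp [Rule.literals, hk]⟩
    have key : ∀ a, Literal.pos a ∈ projection litName I →
        Literal.neg a ∈ projection litName I → False := by
      intro a h1 h2
      obtain ⟨r, hr, hra⟩ := hocc _ h1
      obtain ⟨s, hs, hsa⟩ := hocc _ h2
      exact hb.consistent _ (litName_mem_herbrandUniverse hr hra) _
        (litName_mem_herbrandUniverse hs hsa) ⟨hf.compl a ⟨r, hr, hra⟩ ⟨s, hs, hsa⟩, h1, h2⟩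
    rintro (a | a) h1 h2
    · exact key a h1 h2
    · exact key a h2 h1
  · rw [closedUnder_reduct_iff]
    intro r hr hd hpos
    obtain ⟨c, hc⟩ := P.normal r hr
    have hcr : c ∈ r.head := by simp [hc]
    refine ⟨c, hcr, hb.in_AS _ (litName_mem_herbrandUniverse hr (by simp [Rule.literals, hcr])) _
      (ruleName_mem_herbrandUniverse hr) (fun hn => ?_) (hf.head r hr c hcr)
      (pos_body_true_mem hrule hmod hb hf hr hpos)⟩
    obtain ⟨r', hr', heq, hd'⟩ := mem_model.1 (hmod hn)
    obtain rfl := hrule hr hr' heq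
    exact hd hd'
  · intro B hBA hB l hl
    rw [closedUnder_reduct_iff] at hB
    -- A competitor `B` closed under the reduct is an admissible set for positive bodies. Since
    -- `in_AS` is interpreted by `B`, the bound on `I` puts the projection inside `B`.
    have hmod' := subset_model hlit hrule hI fun r hr hd hpos l hl _ => by
      obtain ⟨k, hk, hkB⟩ := hB r hr hd hpos
      obtain ⟨c, hc⟩ := P.normal r hr
      simp only [hc, List.mem_singleton] at hk hl
      rw [hl, ← hk]
      exact hkB
    obtain ⟨k, hk, heq⟩ := mem_model.1 (hmod' hl)
    rwa [hlit heq]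

omit [LinearOrder C] [Nonempty C] in
theorem PrioritizedProgram.exists_lt_iff (P : PrioritizedProgram α) (ruleName : Rule α → C)
    (R : C → C → Prop) (hirr : ∀ r ∈ P.rules, ¬ R (ruleName r) (ruleName r))
    (htrans : ∀ r ∈ P.rules, ∀ s ∈ P.rules, ∀ t ∈ P.rules, R (ruleName r) (ruleName s) →
      R (ruleName s) (ruleName t) → R (ruleName r) (ruleName t)) :
    ∃ Q : PrioritizedProgram α, Q.rules = P.rules ∧
      ∀ r s, Q.lt r s ↔ r ∈ P.rules ∧ s ∈ P.rules ∧ R (ruleName r) (ruleName s) :=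
  ⟨{ rules := P.rules
     lt := fun r s => r ∈ P.rules ∧ s ∈ P.rules ∧ R (ruleName r) (ruleName s)
     finite := P.finite
     normal := P.normal
     lt_mem := fun _ _ h => ⟨h.1, h.2.1⟩
     irrefl := fun r h => hirr r h.1 h.2.2
     trans := fun r s t h h' => ⟨h.1, h'.2.1, htrans r h.1 s h.2.1 t h'.2.1 h.2.2 h'.2.2⟩ },
    rfl, fun _ _ => Iff.rfl⟩

/-- The predicates `rule`, `pr` and `pr1` encode in `I` the rules of `P` and the orders of `Q₁` and
`Q₂`. -/
structure Encodes (P Q₁ Q₂ : PrioritizedProgram α) (ruleName : Rule α → C)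
    (I : Set (Literal (Atom MetaPred C))) : Prop where
  rules₁ : Q₁.rules = P.rules
  rules₂ : Q₂.rules = P.rules
  rule : ∀ x, lit .rule [x] ∈ I ↔ ∃ r ∈ P.rules, x = ruleName r
  pr : ∀ r ∈ P.rules, ∀ s ∈ P.rules, lit .pr [ruleName r, ruleName s] ∈ I ↔ Q₁.lt r s
  pr1 : ∀ r ∈ P.rules, ∀ s ∈ P.rules, lit .pr1 [ruleName r, ruleName s] ∈ I ↔ Q₂.lt r s

/-- The guessing, transitivity and irreflexivity clauses make `pr` and `pr1` strict total orders on
the rule names, and hence on the rules by injectivity of the naming. The order from `pr` refines the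
given one because it is transitive and contains the covering pairs. -/
theorem exists_encodes (hlit : Function.Injective litName)
    (hrule : Set.InjOn ruleName P.rules)
    (hI : I ∈ answerSets (metaProgram P litName ruleName).ground.rules) :
    ∃ Q₁ ∈ P.fullPrioritizations, ∃ Q₂ : PrioritizedProgram α, Q₂.Total ∧
      projection litName I ∈ Q₂.bPreferred ∧ Encodes P Q₁ Q₂ ruleName I := by
  have hA := projection_mem_answerSets hlit hrule hI
  have hmod := subset_model hlit hrule hI fun r hr hd hp l hl h => h
  obtain ⟨-, hclosed, -⟩ := mem_answerSets_iff.1 hI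
  obtain ⟨hb, hp, hf⟩ := metaClosed_iff.1 hclosed
  have hU : ∀ r ∈ P.rules, ruleName r ∈ (metaProgram P litName ruleName).herbrandUniverse :=
    fun r hr => ruleName_mem_herbrandUniverse hr
  obtain ⟨Q₁, hQ₁, hlt₁⟩ := P.exists_lt_iff ruleName (fun x y => lit .pr [x, y] ∈ I)
    (fun r hr => hp.pr_irrefl _ (hU r hr))
    (fun r hr s hs t ht => hp.pr_trans _ (hU r hr) _ (hU s hs) _ (hU t ht))
  obtain ⟨Q₂, hQ₂, hlt₂⟩ := P.exists_lt_iff ruleName (fun x y => lit .pr1 [x, y] ∈ I)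
    (fun r hr => hp.pr1_irrefl _ (hU r hr))
    (fun r hr s hs t ht => hp.pr1_trans _ (hU r hr) _ (hU s hs) _ (hU t ht))
  have htot₂ : Q₂.Total := by
    intro r hr s hs hne
    rw [hQ₂] at hr hs
    rw [hlt₂, hlt₂]
    rcases hp.pr1_total _ (hU r hr) _ (hU s hs) (fun h => hne (hrule hr hs h)) (hf.rule r hr)
      (hf.rule s hs) with h | h
    · exact Or.inl ⟨hr, hs, h⟩
    · exact Or.inr ⟨hs, hr, h⟩
  have htot₁ : Q₁.Total := by
    intro r hr s hs hne
    rw [hQ₁] at hr hs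
    rw [hlt₁, hlt₁]
    rcases hp.pr_total _ (hU r hr) _ (hU s hs) (fun h => hne (hrule hr hs h)) (hf.rule r hr)
      (hf.rule s hs) with h | h
    · exact Or.inl ⟨hr, hs, h⟩
    · exact Or.inr ⟨hs, hr, h⟩
  have hresp : Q₂.RespectsPriorities (projection litName I) := by
    intro r hr hpos hh
    rw [hQ₂] at hr
    obtain ⟨c, hc⟩ := P.normal r hr
    have hcr : c ∈ r.head := by simp [hc]
    have hcU : litName c ∈ (metaProgram P litName ruleName).herbrandUniverse :=
      litName_mem_herbrandUniverse hr (by simp [Rule.literals, hcr])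
    -- Otherwise the false head would enter `in_CP`, which the last constraint forbids. The bound on
    -- `I` then turns local defeat into a higher-ranked generating rule.
    have hdl : lit .defeat_local [ruleName r] ∈ I := by
      by_contra hn
      have := hp.lit_of_not_in_AS _ hcU _ (hU r hr) hn (hh c hcr) (hf.head r hr c hcr)
        (pos_body_true_mem hrule hmod hb hf hr hpos)
      exact hp.in_CP_sub _ hcU (hh c hcr) (hp.in_CP _ hcU _ (hU r hr) this)
    obtain ⟨r', hr', heq, s, hs, hsr, hg, l, hl, hlr⟩ := mem_model.1 (hmod hdl)
    obtain rfl := hrule hr hr' heq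
    exact ⟨s, (hlt₂ _ _).2 ⟨hs, hr, hsr⟩, hg, l, hl, hlr⟩
  refine ⟨Q₁, ⟨hQ₁, fun r s hrs => ?_, htot₁⟩, Q₂, htot₂,
    (PrioritizedProgram.mem_bPreferred_iff htot₂).2 ⟨by rw [hQ₂]; exact hA, hresp⟩,
    { rules₁ := hQ₁
      rules₂ := hQ₂
      rule := fun x => ⟨fun hx => mem_model.1 (hmod hx), ?_⟩
      pr := fun r hr s hs => by simp [hlt₁, hr, hs]
      pr1 := fun r hr s hs => by simp [hlt₂, hr, hs] }⟩
  · exact PrioritizedProgram.rel_of_lt (fun r s t _ _ _ => Q₁.trans r s t)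
      (fun r s h1 h2 => (hlt₁ _ _).2
        ⟨(P.lt_mem _ _ h1).1, (P.lt_mem _ _ h1).2, hf.pr r s h1 h2⟩) hrs
  · rintro ⟨r, hr, rfl⟩
    exact hf.rule r hr

end

/-! ### The cost as a distance of orders -/

section

variable {α C : Type*} [LinearOrder C] [Nonempty C] {P Q₁ Q₂ : PrioritizedProgram α}
  {litName : Literal α → C} {ruleName : Rule α → C} {A : Set (Literal α)}
  {I : Set (Literal (Atom MetaPred C))}

/-- The cost of an answer set of the meta-interpreter is the distance of the orders it encodes. -/
theorem cost_eq_distance (hrule : Set.InjOn ruleName P.rules) (h : Encodes P Q₁ Q₂ ruleName I) :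
    (metaProgram P litName ruleName).ground.cost I = PrioritizedProgram.distance Q₁ Q₂ := by
  set M := metaProgram P litName ruleName
  obtain ⟨c, hc⟩ := herbrandUniverse_nonempty M
  -- Only `X` and `Y` occur in the weak constraint, so the other variables can be frozen at `c`.
  have hweak : ∀ w, w ∈ M.ground.weak ↔ ∃ x ∈ M.herbrandUniverse, ∃ y ∈ M.herbrandUniverse,
      w = (inversionPenalty C).map (Atom.subst (assign x y c c c)) := by
    intro w
    constructor
    · rintro ⟨w', hw', σ, hσ, rfl⟩
      have : w' = inversionPenalty C := by
        rcases hw' with h | h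
        · exact h
        · exact absurd h (Set.notMem_empty _)
      subst this
      exact ⟨σ .X, hσ _, σ .Y, hσ _, rfl⟩
    · rintro ⟨x, hx, y, hy, rfl⟩
      refine ⟨inversionPenalty C, Or.inl rfl, assign x y c c c, fun v => ?_, rfl⟩
      cases v <;> assumption
  -- The universe is nonempty, so an instance exists and the maximum is not the default value 0.
  -- With level 1 alone and factor `f(1) = 1`, the cost counts the violated instances.
  have hlmax : M.ground.lmax = 1 := by
    have : WeakConstraint.level '' M.ground.weak = {1} := by
      ext n
      simp only [Set.mem_image, Set.mem_singleton_iff, hweak]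
      constructor
      · rintro ⟨_, ⟨x, -, y, -, rfl⟩, rfl⟩
        rfl
      · rintro rfl
        exact ⟨_, ⟨c, hc, c, hc, rfl⟩, rfl⟩
    unfold GroundProgram.lmax
    rw [this, csSup_singleton]
  have hset : {w | w ∈ M.ground.weak ∧ w.level = 1 ∧ w.Violated I} =
      (fun p : Rule α × Rule α =>
        (inversionPenalty C).map (Atom.subst (assign (ruleName p.1) (ruleName p.2) c c c))) ''
        {p | Q₁.lt p.1 p.2 ∧ Q₂.lt p.2 p.1} := by
    ext w
    constructor
    · rintro ⟨hw, -, hv, -⟩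
      obtain ⟨x, hx, y, hy, rfl⟩ := (hweak w).1 hw
      have hv' : lit .rule [x] ∈ I ∧ lit .rule [y] ∈ I ∧ lit .pr [x, y] ∈ I ∧
          lit .pr1 [y, x] ∈ I :=
        ⟨hv _ (by simp [WeakConstraint.map, inversionPenalty, map_subst_lit, Term.subst, assign]),
          hv _ (by simp [WeakConstraint.map, inversionPenalty, map_subst_lit, Term.subst, assign]),
          hv _ (by simp [WeakConstraint.map, inversionPenalty, map_subst_lit, Term.subst, assign]),
          hv _ (by simp [WeakConstraint.map, inversionPenalty, map_subst_lit, Term.subst, assign])⟩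
      obtain ⟨h1, h2, h3, h4⟩ := hv'
      obtain ⟨r, hr, rfl⟩ := (h.rule x).1 h1
      obtain ⟨s, hs, rfl⟩ := (h.rule y).1 h2
      exact ⟨(r, s), ⟨(h.pr r hr s hs).1 h3, (h.pr1 s hs r hr).1 h4⟩, rfl⟩
    · rintro ⟨⟨r, s⟩, ⟨h1, h2⟩, rfl⟩
      have hm := Q₁.lt_mem _ _ h1
      rw [h.rules₁] at hm
      obtain ⟨hr, hs⟩ := hm
      refine ⟨(hweak _).2 ⟨_, ruleName_mem_herbrandUniverse hr, _,
        ruleName_mem_herbrandUniverse hs, rfl⟩, rfl, ?_, ?_⟩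
      · have e1 := (h.rule _).2 ⟨r, hr, rfl⟩
        have e2 := (h.rule _).2 ⟨s, hs, rfl⟩
        have e3 := (h.pr r hr s hs).2 h1
        have e4 := (h.pr1 s hs r hr).2 h2
        simp [WeakConstraint.map, inversionPenalty, map_subst_lit, Term.subst, assign, e1, e2, e3,
          e4]
      · simp [WeakConstraint.map, inversionPenalty]
  -- Ground weak constraints form a set; injective naming ensures that different inverted pairs are
  -- not merged into one instance.
  have hinj : Set.InjOn (fun p : Rule α × Rule α =>
      (inversionPenalty C).map (Atom.subst (assign (ruleName p.1) (ruleName p.2) c c c)))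
      {p | Q₁.lt p.1 p.2 ∧ Q₂.lt p.2 p.1} := by
    rintro ⟨r, s⟩ ⟨h1, -⟩ ⟨r', s'⟩ ⟨h1', -⟩ heq
    have hm := Q₁.lt_mem _ _ h1
    have hm' := Q₁.lt_mem _ _ h1'
    rw [h.rules₁] at hm hm'
    have : [lit .rule [ruleName r], lit .rule [ruleName s],
        lit .pr [ruleName r, ruleName s], lit .pr1 [ruleName s, ruleName r]] =
        [lit .rule [ruleName r'], lit .rule [ruleName s'],
          lit .pr [ruleName r', ruleName s'], lit .pr1 [ruleName s', ruleName r']] :=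
      congrArg WeakConstraint.posBody heq
    simp only [lit, List.cons.injEq, Literal.pos.injEq, Atom.mk.injEq, and_true, true_and] at this
    exact Prod.ext (hrule hm.1 hm'.1 this.1) (hrule hm.2 hm'.2 this.2.1)
  unfold GroundProgram.cost
  rw [hlmax, Finset.Icc_self, Finset.sum_singleton, hset]
  have hone : ∀ w ∈ (fun p : Rule α × Rule α =>
      (inversionPenalty C).map (Atom.subst (assign (ruleName p.1) (ruleName p.2) c c c))) ''
        {p | Q₁.lt p.1 p.2 ∧ Q₂.lt p.2 p.1}, w.weight = 1 := by
    rintro _ ⟨p, -, rfl⟩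
    rfl
  rw [finsum_mem_congr rfl hone, finsum_one, hinj.ncard_image]
  simp [GroundProgram.levelFactor, PrioritizedProgram.distance]

/-! ### From answer sets and orders back to the meta-interpreter -/

omit [Nonempty C] in
theorem projection_model (hlit : Function.Injective litName) (B : Set (Literal α))
    (R₁ R₂ : Rule α → Rule α → Prop) :
    projection litName (model P litName ruleName A B R₁ R₂) = B := by
  ext l
  constructor
  · intro h
    obtain ⟨k, hk, heq⟩ := mem_model.1 h
    rwa [hlit heq]
  · intro h
    exact mem_model.2 ⟨l, h, rfl⟩

theorem metaClosed_model (hlit : Function.Injective litName) (hrule : Set.InjOn ruleName P.rules)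
    (hQ₁ : Q₁ ∈ P.fullPrioritizations) (hQ₂ : Q₂.rules = P.rules) (htot : Q₂.Total)
    (hA : A ∈ answerSets P.rules) (hresp : Q₂.RespectsPriorities A) :
    ClosedUnder (reduct (metaProgram P litName ruleName).ground.rules
      (model P litName ruleName A A Q₁.lt Q₂.lt))
      (model P litName ruleName A A Q₁.lt Q₂.lt) := by
  obtain ⟨hr₁, hlt₁, htot₁⟩ := hQ₁
  refine metaClosed_iff.2 ⟨?_, ?_, ?_⟩
  · exact {
      in_AS := by
        intro x hx ρ hρ hn h1 h2
        obtain ⟨r, hr, l, hl, rfl, rfl⟩ := mem_model.1 h1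
        obtain ⟨r', hr', heq, hrA⟩ := mem_model.1 h2
        obtain rfl := hrule hr hr' heq
        exact mem_model.2 ⟨l, PrioritizedProgram.mem_of_mem_head hA hr
          ⟨hrA, fun hd => hn (mem_model.2 ⟨r, hr, rfl, hd⟩)⟩ hl, rfl⟩
      pos_body_exists := by
        intro x hx ρ hρ h1
        obtain ⟨r, hr, l, hl, rfl, rfl⟩ := mem_model.1 h1
        exact mem_model.2 ⟨r, hr, l, hl, rfl⟩
      pos_body_true := by
        intro ρ hρ hn h1
        obtain ⟨r, hr, rfl⟩ := mem_model.1 h1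
        exact mem_model.2 ⟨r, hr, rfl, fun l hl =>
          (hn (mem_model.2 ⟨r, hr, l, hl, rfl⟩)).elim⟩
      inbetween := by
        intro x hx y hy z hz ρ hρ hxz hzy h1 h2 h3
        obtain ⟨r, hr, l, hl, rfl, rfl⟩ := mem_model.1 h1
        obtain ⟨r', hr', k, hk, rfl, heq⟩ := mem_model.1 h2
        obtain rfl := hrule hr hr' heq
        obtain ⟨r', hr', m, hm, rfl, heq⟩ := mem_model.1 h3
        obtain rfl := hrule hr hr' heq
        exact mem_model.2 ⟨r, hr, rfl, ⟨l, hl, rfl⟩, ⟨k, hk, rfl⟩, m, hm, hxz, hzy⟩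
      notlast := by
        intro x hx y hy ρ hρ hxy h1 h2
        obtain ⟨r, hr, l, hl, rfl, rfl⟩ := mem_model.1 h1
        obtain ⟨r', hr', k, hk, rfl, heq⟩ := mem_model.1 h2
        obtain rfl := hrule hr hr' heq
        exact mem_model.2 ⟨r, hr, rfl, ⟨l, hl, rfl⟩, k, hk, hxy⟩
      notfirst := by
        intro x hx y hy ρ hρ hxy h1 h2
        obtain ⟨r, hr, l, hl, rfl, rfl⟩ := mem_model.1 h1
        obtain ⟨r', hr', k, hk, rfl, heq⟩ := mem_model.1 h2
        obtain rfl := hrule hr hr' heq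
        exact mem_model.2 ⟨r, hr, rfl, ⟨l, hl, rfl⟩, k, hk, hxy⟩
      upto_first := by
        intro x hx ρ hρ hn h1 h2
        obtain ⟨r, hr, l, hl, rfl, rfl⟩ := mem_model.1 h1
        obtain ⟨l', hl', heq⟩ := mem_model.1 h2
        obtain rfl := hlit heq
        refine mem_model.2 ⟨r, hr, rfl, l, hl, rfl, fun k hk hkl => ?_⟩
        rcases hkl.lt_or_eq with h | h
        · exact (hn (mem_model.2 ⟨r, hr, rfl, ⟨l, hl, rfl⟩, k, hk, h⟩)).elim
        · rw [hlit h]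
          exact hl'
      upto_next := by
        intro x hx y hy ρ hρ hyx hn h1 h2 h3
        obtain ⟨r, hr, l, hl, rfl, rfl⟩ := mem_model.1 h2
        obtain ⟨r', hr', heq, m, hm, rfl, hmB⟩ := mem_model.1 h1
        obtain rfl := hrule hr hr' heq
        obtain ⟨l', hl', heq⟩ := mem_model.1 h3
        obtain rfl := hlit heq
        refine mem_model.2 ⟨r, hr, rfl, l, hl, rfl, fun k hk hkl => ?_⟩
        rcases hkl.lt_or_eq with h | h
        · rcases le_or_gt (litName k) (litName m) with h' | h'
          · exact hmB k hk h'
          · exact (hn (mem_model.2 ⟨r, hr, rfl, ⟨m, hm, rfl⟩, ⟨l, hl, rfl⟩, k, hk, h', h⟩)).elim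
        · rw [hlit h]
          exact hl'
      pos_body_true_last := by
        intro x hx ρ hρ hn h1
        obtain ⟨r, hr, rfl, l, hl, rfl, hlB⟩ := mem_model.1 h1
        exact mem_model.2 ⟨r, hr, rfl, fun k hk => hlB k hk
          (not_lt.1 fun h => hn (mem_model.2 ⟨r, hr, rfl, ⟨l, hl, rfl⟩, k, hk, h⟩))⟩
      neg_body_false := by
        intro x hx ρ hρ h1 h2
        obtain ⟨r, hr, l, hl, rfl, rfl⟩ := mem_model.1 h1
        obtain ⟨k, hk, heq⟩ := mem_model.1 h2
        obtain rfl := hlit heq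
        exact mem_model.2 ⟨r, hr, rfl, l, hl, hk⟩
      consistent := by
        rintro x hx y hy ⟨h1, h2, h3⟩
        obtain ⟨a, -, -, rfl, rfl⟩ := mem_model.1 h1
        obtain ⟨k, hk, heq⟩ := mem_model.1 h2
        obtain rfl := hlit heq
        obtain ⟨k, hk', heq⟩ := mem_model.1 h3
        obtain rfl := hlit heq
        exact (mem_answerSets_iff.1 hA).1 _ hk hk' }
  · exact {
      pr_total := by
        intro x hx y hy hne h1 h2
        obtain ⟨r, hr, rfl⟩ := mem_model.1 h1
        obtain ⟨s, hs, rfl⟩ := mem_model.1 h2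
        rcases htot₁ r (by rwa [hr₁]) s (by rwa [hr₁]) (by rintro rfl; exact hne rfl) with h | h
        · exact Or.inl (mem_model.2 ⟨r, hr, s, hs, h, rfl, rfl⟩)
        · exact Or.inr (mem_model.2 ⟨s, hs, r, hr, h, rfl, rfl⟩)
      pr_trans := by
        intro x hx y hy z hz h1 h2
        obtain ⟨r, hr, s, hs, hrs, rfl, rfl⟩ := mem_model.1 h1
        obtain ⟨s', hs', t, ht, hst, heq, rfl⟩ := mem_model.1 h2
        obtain rfl := hrule hs hs' heq
        exact mem_model.2 ⟨r, hr, t, ht, Q₁.trans _ _ _ hrs hst, rfl, rfl⟩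
      pr_irrefl := by
        intro x hx h
        obtain ⟨r, hr, s, hs, hrs, rfl, heq⟩ := mem_model.1 h
        obtain rfl := hrule hr hs heq
        exact Q₁.irrefl _ hrs
      pr1_total := by
        intro x hx y hy hne h1 h2
        obtain ⟨r, hr, rfl⟩ := mem_model.1 h1
        obtain ⟨s, hs, rfl⟩ := mem_model.1 h2
        rcases htot r (by rwa [hQ₂]) s (by rwa [hQ₂]) (by rintro rfl; exact hne rfl) with h | h
        · exact Or.inl (mem_model.2 ⟨r, hr, s, hs, h, rfl, rfl⟩)
        · exact Or.inr (mem_model.2 ⟨s, hs, r, hr, h, rfl, rfl⟩)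
      pr1_trans := by
        intro x hx y hy z hz h1 h2
        obtain ⟨r, hr, s, hs, hrs, rfl, rfl⟩ := mem_model.1 h1
        obtain ⟨s', hs', t, ht, hst, heq, rfl⟩ := mem_model.1 h2
        obtain rfl := hrule hs hs' heq
        exact mem_model.2 ⟨r, hr, t, ht, Q₂.trans _ _ _ hrs hst, rfl, rfl⟩
      pr1_irrefl := by
        intro x hx h
        obtain ⟨r, hr, s, hs, hrs, rfl, heq⟩ := mem_model.1 h
        obtain rfl := hrule hr hs heq
        exact Q₂.irrefl _ hrs
      lit_of_not_in_AS := by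
        intro x hx ρ hρ hn hn' h1 h2
        obtain ⟨r, hr, l, hl, rfl, rfl⟩ := mem_model.1 h1
        obtain ⟨r', hr', heq, hrA⟩ := mem_model.1 h2
        obtain rfl := hrule hr hr' heq
        obtain ⟨c, hc⟩ := P.normal r hr
        -- This is the clause where B-preferredness enters: for a rule with false head it yields
        -- `defeat_local`, so this clause for `lit` is removed by the reduct.
        obtain ⟨s, hsr, hg, k, hk, hkr⟩ := hresp r (by rwa [hQ₂]) hrA fun k hk hkA => hn' <| by
          simp only [hc, List.mem_singleton] at hk hl
          rw [hl, ← hk]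
          exact mem_model.2 ⟨k, hkA, rfl⟩
        have hs := (Q₂.lt_mem _ _ hsr).1
        rw [hQ₂] at hs
        exact (hn (mem_model.2 ⟨r, hr, rfl, s, hs, hsr, hg, k, hk, hkr⟩)).elim
      lit_of_not_defeat_global := by
        intro x hx ρ hρ hn hn' h1 h2
        obtain ⟨r, hr, l, hl, rfl, rfl⟩ := mem_model.1 h1
        obtain ⟨r', hr', heq, hrA⟩ := mem_model.1 h2
        obtain rfl := hrule hr hr' heq
        exact mem_model.2 ⟨r, hr, l, hl, rfl, rfl, hrA,
          fun hd => hn' (mem_model.2 ⟨r, hr, rfl, hd⟩)⟩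
      defeat_local := by
        intro x hx ρ hρ ρ' hρ' h1 h2 h3
        obtain ⟨r, hr, l, hl, rfl, rfl⟩ := mem_model.1 h1
        obtain ⟨s, hs, l', hl', heq, rfl, hg⟩ := mem_model.1 h2
        obtain rfl := hlit heq
        obtain ⟨s', hs', r', hr', hlt, heq', heq⟩ := mem_model.1 h3
        obtain rfl := hrule hs hs' heq'
        obtain rfl := hrule hr hr' heq
        exact mem_model.2 ⟨r, hr, rfl, s, hs, hlt, hg, l, hl', hl⟩
      defeat_global := by
        intro x hx ρ hρ h1 h2
        obtain ⟨r, hr, l, hl, rfl, rfl⟩ := mem_model.1 h1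
        obtain ⟨k, hk, heq⟩ := mem_model.1 h2
        obtain rfl := hlit heq
        exact mem_model.2 ⟨r, hr, rfl, l, hl, hk⟩
      in_CP := by
        intro x hx ρ hρ h1
        obtain ⟨r, hr, l, hl, rfl, -, hg⟩ := mem_model.1 h1
        exact mem_model.2 ⟨l, PrioritizedProgram.mem_of_mem_head hA hr hg hl, rfl⟩
      in_CP_sub := by
        intro x hx hn h
        obtain ⟨l, hl, rfl⟩ := mem_model.1 h
        exact hn (mem_model.2 ⟨l, hl, rfl⟩) }
  · exact {
      rule := fun r hr => mem_model.2 ⟨r, hr, rfl⟩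
      head := fun r hr l hl => mem_model.2 ⟨r, hr, l, hl, rfl, rfl⟩
      pbl := fun r hr l hl => mem_model.2 ⟨r, hr, l, hl, rfl, rfl⟩
      nbl := fun r hr l hl => mem_model.2 ⟨r, hr, l, hl, rfl, rfl⟩
      compl := fun a h1 h2 => mem_model.2 ⟨a, h1, h2, rfl, rfl⟩
      pr := fun r s h1 h2 => mem_model.2
        ⟨r, (P.lt_mem _ _ h1).1, s, (P.lt_mem _ _ h1).2, hlt₁ _ _ h1, rfl, rfl⟩ }

/-- For minimality, a closed subset `J` of the interpretation is shown to contain each of its atoms,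
in order of dependency: `in_AS`, then truth of positive bodies, the orders, `lit` for generating
rules, and the rest. -/
theorem model_mem_answerSets (hlit : Function.Injective litName)
    (hrule : Set.InjOn ruleName P.rules)
    (hQ₁ : Q₁ ∈ P.fullPrioritizations) (hQ₂ : Q₂.rules = P.rules) (htot : Q₂.Total)
    (hA : A ∈ answerSets P.rules) (hresp : Q₂.RespectsPriorities A) :
    model P litName ruleName A A Q₁.lt Q₂.lt ∈
      answerSets (metaProgram P litName ruleName).ground.rules := by
  refine mem_answerSets_iff.2 ⟨consistent_model,
    metaClosed_model hlit hrule hQ₁ hQ₂ htot hA hresp, fun J hJ hclosed => ?_⟩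
  obtain ⟨hr₁, hlt₁, htot₁⟩ := hQ₁
  obtain ⟨hb, hp, hf⟩ := metaClosed_iff.1 hclosed
  have hU : ∀ r ∈ P.rules, ruleName r ∈ (metaProgram P litName ruleName).herbrandUniverse :=
    fun r hr => ruleName_mem_herbrandUniverse hr
  have hlU : ∀ r ∈ P.rules, ∀ l ∈ r.literals,
      litName l ∈ (metaProgram P litName ruleName).herbrandUniverse :=
    fun r hr l hl => litName_mem_herbrandUniverse hr hl
  have hhead : ∀ r ∈ P.rules, ∀ l ∈ r.head, l ∈ r.literals := fun r _ l hl => by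
    simp [Rule.literals, hl]
  have hpos : ∀ r ∈ P.rules, ∀ l ∈ r.posBody, l ∈ r.literals := fun r _ l hl => by
    simp [Rule.literals, hl]
  have hneg : ∀ r ∈ P.rules, ∀ l ∈ r.negBody, l ∈ r.literals := fun r _ l hl => by
    simp [Rule.literals, hl]
  have hAS : ∀ l ∈ A, lit .in_AS [litName l] ∈ J := by
    intro l hl
    -- Minimality of `A` is transferred: the literals of `A` whose `in_AS` atom lies in `J` are
    -- closed under the reduct of `P`.
    have := (mem_answerSets_iff.1 hA).2.2 {l | l ∈ A ∧ lit .in_AS [litName l] ∈ J}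
      (fun l hl => hl.1) ?_
    · exact (this hl).2
    · rw [closedUnder_reduct_iff]
      intro r hr hd hbody
      obtain ⟨c, hc⟩ := P.normal r hr
      have hcr : c ∈ r.head := by simp [hc]
      refine ⟨c, hcr, PrioritizedProgram.mem_of_mem_head hA hr
        ⟨fun l hl => (hbody l hl).1, hd⟩ hcr, ?_⟩
      refine hb.in_AS _ (hlU r hr _ (hhead r hr c hcr)) _ (hU r hr) (fun hn => ?_)
        (hf.head r hr c hcr)
        (pos_body_true_mem hrule subset_rfl hb hf hr fun k hk => (hbody k hk).2)
      obtain ⟨r', hr', heq, hd'⟩ := mem_model.1 hn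
      obtain rfl := hrule hr hr' heq
      exact hd hd'
  have hpbt : ∀ r ∈ P.rules, (∀ l ∈ r.posBody, l ∈ A) → lit .pos_body_true [ruleName r] ∈ J :=
    fun r hr h => pos_body_true_mem hrule subset_rfl hb hf hr fun k hk => hAS k (h k hk)
  have hpr1 : ∀ r ∈ P.rules, ∀ s ∈ P.rules, Q₂.lt r s →
      lit .pr1 [ruleName r, ruleName s] ∈ J := by
    intro r hr s hs hrs
    -- The disjunctive head leaves a choice, but the reversed pair is not in the interpretation,
    -- which contains `J`.
    rcases hp.pr1_total _ (hU r hr) _ (hU s hs) (fun h => Q₂.irrefl s (by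
      rwa [hrule hr hs h] at hrs)) (hf.rule r hr) (hf.rule s hs) with h | h
    · exact h
    · obtain ⟨s', hs', r', hr', hlt, heq, heq'⟩ := mem_model.1 (hJ h)
      obtain rfl := hrule hs hs' heq
      obtain rfl := hrule hr hr' heq'
      exact absurd hlt (Q₂.asymm hrs)
  have hpr : ∀ r ∈ P.rules, ∀ s ∈ P.rules, Q₁.lt r s →
      lit .pr [ruleName r, ruleName s] ∈ J := by
    intro r hr s hs hrs
    rcases hp.pr_total _ (hU r hr) _ (hU s hs) (fun h => Q₁.irrefl s (by
      rwa [hrule hr hs h] at hrs)) (hf.rule r hr) (hf.rule s hs) with h | h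
    · exact h
    · obtain ⟨s', hs', r', hr', hlt, heq, heq'⟩ := mem_model.1 (hJ h)
      obtain rfl := hrule hs hs' heq
      obtain rfl := hrule hr hr' heq'
      exact absurd hlt (Q₁.asymm hrs)
  have hlitJ : ∀ r ∈ P.rules, ∀ l ∈ r.head, (∀ k ∈ r.posBody, k ∈ A) → ¬ Defeats A r →
      lit .lit [litName l, ruleName r] ∈ J := by
    intro r hr l hl hbody hd
    -- Neither negated atom holds for a generating rule: local defeat would come from the head of
    -- another generating rule, a member of `A`, and would thus be defeat by `A`.
    refine hp.lit_of_not_defeat_global _ (hlU r hr _ (hhead r hr l hl)) _ (hU r hr) (fun h => ?_)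
      (fun h => ?_) (hf.head r hr l hl) (hpbt r hr hbody)
    · obtain ⟨r', hr', heq, s, hs, -, hg, k, hk, hkr⟩ := mem_model.1 h
      obtain rfl := hrule hr hr' heq
      exact hd ⟨k, hkr, PrioritizedProgram.mem_of_mem_head hA hs hg hk⟩
    · obtain ⟨r', hr', heq, hd'⟩ := mem_model.1 h
      obtain rfl := hrule hr hr' heq
      exact hd hd'
  rintro _ ⟨p, ts, rfl, h⟩
  unfold Interp at h
  split at h
  · obtain ⟨r, hr, rfl⟩ := h
    exact hf.rule r hr
  · obtain ⟨r, hr, l, hl, rfl, rfl⟩ := h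
    exact hf.head r hr l hl
  · obtain ⟨r, hr, l, hl, rfl, rfl⟩ := h
    exact hf.pbl r hr l hl
  · obtain ⟨r, hr, l, hl, rfl, rfl⟩ := h
    exact hf.nbl r hr l hl
  · obtain ⟨a, h1, h2, rfl, rfl⟩ := h
    exact hf.compl a h1 h2
  · obtain ⟨l, hl, rfl⟩ := h
    exact hAS l hl
  · obtain ⟨r, hr, l, hl, rfl⟩ := h
    exact hb.pos_body_exists _ (hlU r hr l (hpos r hr l hl)) _ (hU r hr) (hf.pbl r hr l hl)
  · obtain ⟨r, hr, rfl, hbody⟩ := h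
    exact hpbt r hr hbody
  · obtain ⟨r, hr, rfl, ⟨l, hl, rfl⟩, ⟨k, hk, rfl⟩, m, hm, h1, h2⟩ := h
    exact hb.inbetween _ (hlU r hr l (hpos r hr l hl)) _ (hlU r hr k (hpos r hr k hk)) _
      (hlU r hr m (hpos r hr m hm)) _ (hU r hr) h1 h2 (hf.pbl r hr l hl) (hf.pbl r hr k hk)
      (hf.pbl r hr m hm)
  · obtain ⟨r, hr, rfl, ⟨l, hl, rfl⟩, k, hk, h1⟩ := h
    exact hb.notlast _ (hlU r hr l (hpos r hr l hl)) _ (hlU r hr k (hpos r hr k hk)) _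
      (hU r hr) h1 (hf.pbl r hr l hl) (hf.pbl r hr k hk)
  · obtain ⟨r, hr, rfl, ⟨l, hl, rfl⟩, k, hk, h1⟩ := h
    exact hb.notfirst _ (hlU r hr l (hpos r hr l hl)) _ (hlU r hr k (hpos r hr k hk)) _
      (hU r hr) h1 (hf.pbl r hr l hl) (hf.pbl r hr k hk)
  · obtain ⟨r, hr, rfl, l, hl, rfl, hlA⟩ := h
    exact pos_body_true_upto_mem hrule subset_rfl hb hf hr hl fun k hk hkl => hAS k (hlA k hk hkl)
  · obtain ⟨r, hr, rfl, k, hk, hkA⟩ := h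
    exact hb.neg_body_false _ (hlU r hr k (hneg r hr k hk)) _ (hU r hr) (hf.nbl r hr k hk)
      (hAS k hkA)
  · obtain ⟨r, hr, s, hs, hlt, rfl, rfl⟩ := h
    exact hpr r hr s hs hlt
  · obtain ⟨r, hr, s, hs, hlt, rfl, rfl⟩ := h
    exact hpr1 r hr s hs hlt
  · obtain ⟨r, hr, l, hl, rfl, rfl, hg⟩ := h
    exact hlitJ r hr l hl hg.1 hg.2
  · obtain ⟨r, hr, rfl, s, hs, hlt, hg, l, hl, hlr⟩ := h
    exact hp.defeat_local _ (hlU r hr l (hneg r hr l hlr)) _ (hU r hr) _ (hU s hs)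
      (hf.nbl r hr l hlr) (hlitJ s hs l hl hg.1 hg.2) (hpr1 s hs r hr hlt)
  · obtain ⟨r, hr, rfl, k, hk, hkA⟩ := h
    exact hp.defeat_global _ (hlU r hr k (hneg r hr k hk)) _ (hU r hr) (hf.nbl r hr k hk)
      (hAS k hkA)
  · obtain ⟨l, hl, rfl⟩ := h
    obtain ⟨r, hr, hg, hlr⟩ := PrioritizedProgram.exists_generating hA hl
    exact hp.in_CP _ (hlU r hr l (hhead r hr l hlr)) _ (hU r hr) (hlitJ r hr l hlr hg.1 hg.2)
  · exact h.elim

omit [Nonempty C] in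
theorem encodes_model (hrule : Set.InjOn ruleName P.rules)
    (hQ₁ : Q₁.rules = P.rules) (hQ₂ : Q₂.rules = P.rules) :
    Encodes P Q₁ Q₂ ruleName (model P litName ruleName A A Q₁.lt Q₂.lt) where
  rules₁ := hQ₁
  rules₂ := hQ₂
  rule x := mem_model
  pr r hr s hs := by
    constructor
    · intro h
      obtain ⟨r', hr', s', hs', hlt, heq, heq'⟩ := mem_model.1 h
      obtain rfl := hrule hr hr' heq
      obtain rfl := hrule hs hs' heq'
      exact hlt
    · intro h
      exact mem_model.2 ⟨r, hr, s, hs, h, rfl, rfl⟩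
  pr1 r hr s hs := by
    constructor
    · intro h
      obtain ⟨r', hr', s', hs', hlt, heq, heq'⟩ := mem_model.1 h
      obtain rfl := hrule hr hr' heq
      obtain rfl := hrule hs hs' heq'
      exact hlt
    · intro h
      exact mem_model.2 ⟨r, hr, s, hs, h, rfl, rfl⟩

/-- The interpretation is built from a pair of orders that attains the violation degree. -/
theorem exists_cost_eq_violationDegree (hlit : Function.Injective litName)
    (hrule : Set.InjOn ruleName P.rules) (hA : A ∈ answerSets P.rules) :
    ∃ I ∈ answerSets (metaProgram P litName ruleName).ground.rules, projection litName I = A ∧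
      (metaProgram P litName ruleName).ground.cost I = P.violationDegree A := by
  obtain ⟨Q₁, hQ₁, Q₂, hQ₂, htot, hpref, hd⟩ :=
    PrioritizedProgram.exists_distance_eq_violationDegree hA
  exact ⟨_, model_mem_answerSets hlit hrule hQ₁ hQ₂ htot hA
    ((PrioritizedProgram.mem_bPreferred_iff htot).1 hpref).2, projection_model hlit _ _ _,
    (cost_eq_distance hrule (encodes_model hrule hQ₁.1 hQ₂)).trans hd.symm⟩

/-- The two orders encoded in `I` are one of the pairs over which the violation degree is minimized.
-/
theorem violationDegree_projection_le_cost (hlit : Function.Injective litName)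
    (hrule : Set.InjOn ruleName P.rules)
    (hI : I ∈ answerSets (metaProgram P litName ruleName).ground.rules) :
    P.violationDegree (projection litName I) ≤
      (metaProgram P litName ruleName).ground.cost I := by
  obtain ⟨Q₁, hQ₁, Q₂, htot, hpref, henc⟩ := exists_encodes hlit hrule hI
  rw [cost_eq_distance hrule henc]
  exact PrioritizedProgram.violationDegree_le hQ₁ henc.rules₂ htot hpref

end

end ASP

theorem theorem7 {α C : Type*} [LinearOrder C] [Nonempty C]
    (P : ASP.PrioritizedProgram α)
    (litName : ASP.Literal α → C) (hlit : Function.Injective litName)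
    (ruleName : ASP.Rule α → C) (hrule : Set.InjOn ruleName P.rules) :
    (∀ A ∈ (ASP.weakMetaInterpreter C ∪
          ASP.representation P litName ruleName).optimalAnswerSets,
        ASP.projection litName A ∈ P.weaklyPreferred) ∧
    (∀ A ∈ P.weaklyPreferred,
      ∃ A' ∈ (ASP.weakMetaInterpreter C ∪
          ASP.representation P litName ruleName).optimalAnswerSets,
        ASP.projection litName A' = A) := by
  constructor
  · rintro I ⟨hI, hopt⟩
    refine ASP.PrioritizedProgram.mem_weaklyPreferred_iff.2
      ⟨ASP.projection_mem_answerSets hlit hrule hI, fun B hB => ?_⟩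
    obtain ⟨J, hJ, -, hcost⟩ := ASP.exists_cost_eq_violationDegree hlit hrule hB
    -- A cheapest representative `J` of the competitor `B` costs exactly its violation degree, and
    -- `I` costs no more than `J`.
    exact ((ASP.violationDegree_projection_le_cost hlit hrule hI).trans (hopt J hJ)).trans
      hcost.le
  · intro A hA
    obtain ⟨hA, hmin⟩ := ASP.PrioritizedProgram.mem_weaklyPreferred_iff.1 hA
    obtain ⟨I, hI, hproj, hcost⟩ := ASP.exists_cost_eq_violationDegree hlit hrule hA
    refine ⟨I, ⟨hI, fun J hJ => hcost.le.trans ?_⟩, hproj⟩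
    exact (hmin _ (ASP.projection_mem_answerSets hlit hrule hJ)).trans
      (ASP.violationDegree_projection_le_cost hlit hrule hJ)
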